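/- Conventions. Simplicial complexes are finite and contain the empty face; the dimension of a face $F$ is $|F|-1$. The boundary $\partial\Delta$ of a pure $D$-dimensional complex (in particular of a simplex or a ball) is the subcomplex generated by the $(D-1)$-faces contained in exactly one facet. A pure $D$-dimensional complex is *shellable* if its facets can be listed as $F_1,\dots,F_m$ so that for each $j\ge 2$ the complex $\overline{F_j}\cap(\overline{F_1}\cup\dots\cup\overline{F_{j-1}})$ is pure of dimension $D-1$, where $\overline F$ is the complex of all subsets of $F$. A $D$-dimensional complex is *constructible* if it is a simplex, or it is the union of two $D$-dimensional constructible complexes whose intersection is a $(D-1)$-dimensional constructible complex. The Nevo–Santos–Wilson spheres. Let $d\ge 2$ and $n\ge 2$. Let $\mathcal T$ be the join of $d$ paths with $n$ vertices each, the $\ell$-th path having vertices $a^{(\ell)}_1,\dots,a^{(\ell)}_n$ and edges $\{a^{(\ell)}_i,a^{(\ell)}_{i+1}\}$. The facets of $\mathcal T$ are the sets $\sigma=\bigcup_{\ell}\{a^{(\ell)}_{i_\ell},a^{(\ell)}_{i_\ell+1}\}$ with $(i_1,\dots,i_d)\in\{1,\dots,n-1\}^d$; write $\sum\sigma=i_1+\dots+i_d$.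 For $k\ge 1$ let $\mathbf B_k$ be the subcomplex of $\mathcal T$ generated by the facets $\sigma$ with $(k-1)(d+2)\le\sum\sigma\le k(d+2)-1$. The nonempty $\mathbf B_k$ are those with $1\le k\le K:=\lfloor d(n-1)/(d+2)\rfloor+1$, and $\mathcal T=\mathbf B_1\cup\dots\cup\mathbf B_K$. For $1\le k\le K$ define $\mathcal T_k$ as follows. If $\mathbf B_k$ is a single simplex, put $\mathcal T_k=\mathbf B_k$. Otherwise introduce a new vertex $o_k$, let $\mathcal S_k$ be the set of facets $\sigma$ of $\mathbf B_k$ with $\sum\sigma=(k-1)(d+2)$ or $\sum\sigma=k(d+2)-1$, and: - for $\sigma\in\mathcal S_k$ put $D_\sigma=\overline\sigma\cap\partial\mathbf B_k$, let $F_\sigma$ be the unique set of vertices of $D_\sigma$ that is not a face of $D_\sigma$ while all its proper subsets are, put $G_\sigma=\sigma\setminus F_\sigma$, and choose $\widetilde C_\sigma$ to be either of the two complexes $F_\sigma*\partial(G_\sigma*o_k)$ and $\partial F_\sigma*(G_\sigma*o_k)$; - let $\mathcal C_k$ be the set of $(2d-2)$-faces of $\partial\mathbf B_k$ contained in no $D_\sigma$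 with $\sigma\in\mathcal S_k$. Then put $\mathcal T_k=\bigcup_{\sigma\in\mathcal S_k}\widetilde C_\sigma\cup\bigcup_{\tau\in\mathcal C_k}(\tau*o_k)$. Finally, let $\widetilde{\mathcal T}=\mathcal T_1\cup\dots\cup\mathcal T_K$, let $o$ be one more new vertex, and form the complex $\widetilde{\mathcal T}\cup(\partial\widetilde{\mathcal T}*o)$. **Theorem.** 1. For all $d\ge 2$, all $n\ge 2$ and every choice of the triangulations $\widetilde C_\sigma$, the complex $\widetilde{\mathcal T}\cup(\partial\widetilde{\mathcal T}*o)$ is constructible of dimension $2d-1$. 2. For $d=2$, all $n\ge 2$ and every choice of the triangulations $\widetilde C_\sigma$, the $3$-dimensional complex $\widetilde{\mathcal T}\cup(\partial\widetilde{\mathcal T}*o)$ is shellable. -/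

import Mathlib

namespace NSW

/-- A simplicial complex on vertices from `V`: a collection of finite subsets of `V` that is closed
under taking subsets. As usual in this combinatorial setting the empty set counts as a face (of
dimension `-1`); `∪`, `∩` of complexes are `⊔`, `⊓`. -/
abbrev SComplex (V : Type*) : Type _ := LowerSet (Finset V)

section Complexes

variable {V : Type*}

/-- The simplex on `F`: all subsets of `F`. -/
def simplex (F : Finset V) : SComplex V := LowerSet.Iic F

/-- Facets: the faces that are maximal under inclusion. -/
def IsFacet (Δ : SComplex V) (F : Finset V) : Prop := Maximal (fun G => G ∈ Δ) F

/-- `Δ` is pure of dimension `D`: it is nonempty, every face lies in a facet (automatic for finite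
complexes), and every facet has dimension `D`, where `dim F = |F| - 1`. -/
def IsPure (D : ℤ) (Δ : SComplex V) : Prop :=
  (∃ F, F ∈ Δ) ∧ (∀ F ∈ Δ, ∃ G, IsFacet Δ G ∧ F ⊆ G) ∧ ∀ G, IsFacet Δ G → (G.card : ℤ) - 1 = D

/-- `Δ` is a shellable complex of dimension `D`: it is pure of dimension `D` and its facets can be
listed as `F 0, …, F (m - 1)`, without repetition, such that each facet after the first meets the
union of the preceding ones in a pure complex of dimension `D - 1`. -/
def IsShellable (D : ℤ) (Δ : SComplex V) : Prop :=
  IsPure D Δ ∧ ∃ (m : ℕ) (F : Fin m → Finset V),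
    Function.Injective F ∧ (∀ G, IsFacet Δ G ↔ ∃ j, F j = G) ∧
    ∀ j : Fin m, 0 < j.val →
      IsPure (D - 1) (simplex (F j) ⊓ ⨆ (i : Fin m) (_ : i < j), simplex (F i))

/-- `Δ` is a constructible complex of dimension `D`: a `D`-simplex, or a union of two constructible
complexes of dimension `D` whose intersection is constructible of dimension `D - 1`.
(Such complexes are automatically pure.) -/
inductive IsConstructible : ℤ → SComplex V → Prop
  | ofSimplex (F : Finset V) : IsConstructible ((F.card : ℤ) - 1) (simplex F)
  | glue {D : ℤ} {Δ₁ Δ₂ : SComplex V} : IsConstructible D Δ₁ → IsConstructible D Δ₂ →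
      IsConstructible (D - 1) (Δ₁ ⊓ Δ₂) → IsConstructible D (Δ₁ ⊔ Δ₂)

/-- The boundary complex of a pure complex: it is generated by the codimension-one faces that
are contained in exactly one facet. -/
def boundary (Δ : SComplex V) : SComplex V where
  carrier := {G | ∃ H F, G ⊆ H ∧ IsFacet Δ F ∧ H ⊆ F ∧ H.card + 1 = F.card ∧
    ∀ F', IsFacet Δ F' → H ⊆ F' → F' = F}
  lower' := by
    rintro G G' hle ⟨H, F, hG, h⟩
    exact ⟨H, F, subset_trans hle hG, h⟩

/-- The join of two complexes (used only for complexes on disjoint vertex sets). -/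
def join [DecidableEq V] (Δ Γ : SComplex V) : SComplex V where
  carrier := {H | ∃ F ∈ Δ, ∃ G ∈ Γ, H = F ∪ G}
  lower' := by
    rintro H H' hle ⟨F, hF, G, hG, rfl⟩
    refine ⟨H' ∩ F, Δ.lower Finset.inter_subset_right hF,
      H' ∩ G, Γ.lower Finset.inter_subset_right hG, ?_⟩
    rw [← Finset.inter_union_distrib_left]
    exact (Finset.inter_eq_left.mpr hle).symm

/-- The cone over `Δ` with apex `v`. -/
def cone [DecidableEq V] (Δ : SComplex V) (v : V) : SComplex V := join Δ (simplex {v})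

/-- `F` is a missing face of `Δ`: a set of vertices of `Δ` which is not a face, while all its
proper subsets are faces. -/
def IsMissingFace (Δ : SComplex V) (F : Finset V) : Prop :=
  (∀ v ∈ F, {v} ∈ Δ) ∧ F ∉ Δ ∧ ∀ G, G ⊂ F → G ∈ Δ

open Classical in
/-- The missing face of a complex that has exactly one (the default value is never used below). -/
noncomputable def missingFace (Δ : SComplex V) : Finset V :=
  if h : ∃ F, IsMissingFace Δ F then h.choose else ∅

end Complexes

/-- The vertices: `a l i` is the `i`-th vertex of the `l`-th path (positions count from 1),
`o k` is the new vertex for the `k`-th ball, and `apex` is the last new vertex. -/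
inductive Vertex (d : ℕ) : Type
  | a (l : Fin d) (i : ℕ) : Vertex d
  | o (k : ℕ) : Vertex d
  | apex : Vertex d
  deriving DecidableEq

variable {d : ℕ}

/-- The facet of the join of the `d` paths with index tuple `i`: the union over `l` of the edges
`{a l (i l), a l (i l + 1)}`. -/
def cell (i : Fin d → ℕ) : Finset (Vertex d) :=
  Finset.univ.biUnion fun l => {Vertex.a l (i l), Vertex.a l (i l + 1)}

/-- The index tuples in `[n-1]^d` (the facets of the join of `d` paths with `n` vertices each) whose
index sum lies between `(k-1)(d+2)` and `k(d+2)-1`. -/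
def slabIndices (d n k : ℕ) : Finset (Fin d → ℕ) :=
  (Fintype.piFinset fun _ : Fin d => Finset.Icc 1 (n - 1)).filter fun i =>
    (k - 1) * (d + 2) ≤ ∑ l, i l ∧ ∑ l, i l ≤ k * (d + 2) - 1

/-- The `k`-th slab of the join of the paths. -/
def slab (d n k : ℕ) : SComplex (Vertex d) := ⨆ i ∈ slabIndices d n k, simplex (cell i)

/-- The lower diagonal: index sum `(k-1)(d+2)`. -/
def diagLow (d n k : ℕ) : Finset (Fin d → ℕ) :=
  (slabIndices d n k).filter fun i => ∑ l, i l = (k - 1) * (d + 2)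

/-- The upper diagonal: index sum `k(d+2)-1`. -/
def diagUp (d n k : ℕ) : Finset (Fin d → ℕ) :=
  (slabIndices d n k).filter fun i => ∑ l, i l = k * (d + 2) - 1

/-- `D_σ`: the part of the facet `σ` on the boundary of its slab. -/
def cellBoundary (n k : ℕ) (i : Fin d → ℕ) : SComplex (Vertex d) :=
  simplex (cell i) ⊓ boundary (slab d n k)

/-- `F_σ`. -/
noncomputable def cellF (n k : ℕ) (i : Fin d → ℕ) : Finset (Vertex d) :=
  missingFace (cellBoundary n k i)

/-- `G_σ`, the complement of `F_σ` in `σ`. -/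
noncomputable def cellG (n k : ℕ) (i : Fin d → ℕ) : Finset (Vertex d) :=
  cell i \ cellF n k i

/-- The triangulation of the polyhedral cell `C_σ`: for `b = true` it is
`F_σ * ∂(G_σ * o_k)`, for `b = false` it is `∂F_σ * (G_σ * o_k)`. -/
noncomputable def cellTriangulation (n k : ℕ) (b : Bool) (i : Fin d → ℕ) : SComplex (Vertex d) :=
  if b then
    join (simplex (cellF n k i)) (boundary (cone (simplex (cellG n k i)) (Vertex.o k)))
  else
    join (boundary (simplex (cellF n k i))) (cone (simplex (cellG n k i)) (Vertex.o k))

/-- The `(2d-2)`-simplices on the boundary of the slab that lie in no `D_σ` for `σ` on one of the two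
diagonals. -/
def connectingFaces (d n k : ℕ) : Set (Finset (Vertex d)) :=
  {τ | τ ∈ boundary (slab d n k) ∧ (τ.card : ℤ) - 1 = 2 * d - 2 ∧
    ∀ i ∈ diagLow d n k ∪ diagUp d n k, τ ∉ cellBoundary n k i}

/-- The ball `T_k` that replaces the `k`-th slab; a slab that is a single simplex is kept. The
triangulation of `C_σ` is chosen by `c σ` (each `σ` lies in only one slab). -/
noncomputable def newBall (n k : ℕ) (c : (Fin d → ℕ) → Bool) : SComplex (Vertex d) :=
  if (slabIndices d n k).card = 1 then slab d n k
  else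
    (⨆ i ∈ diagLow d n k, cellTriangulation n k (c i) i) ⊔
    (⨆ τ ∈ connectingFaces d n k, cone (simplex τ) (Vertex.o k)) ⊔
    (⨆ i ∈ diagUp d n k, cellTriangulation n k (c i) i)

/-- The union of all balls `T_k`. The index sums of the facets of the join run from `d` to
`d(n-1)`, so the nonempty slabs are exactly those with `1 ≤ k ≤ ⌊d(n-1)/(d+2)⌋ + 1`. -/
noncomputable def fullBall (n : ℕ) (c : (Fin d → ℕ) → Bool) : SComplex (Vertex d) :=
  ⨆ k ∈ Finset.Icc 1 (d * (n - 1) / (d + 2) + 1), newBall n k c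

/-- The Nevo–Santos–Wilson sphere: the union of the ball and the cone over its boundary. -/
noncomputable def sphere (n : ℕ) (c : (Fin d → ℕ) → Bool) : SComplex (Vertex d) :=
  fullBall n c ⊔ cone (boundary (fullBall n c)) Vertex.apex

end NSW

/-! A single shelling, valid for every d ≥ 2 and every choice of triangulations, gives both claims:
shelled families are constructible (`Shelled.isConstructible`), and the second claim is the case d =
2 of `Shelled.isShellable`.

Every cell σ of a slab contributes a small set of facets on W = σ ∪ {o}. Let A be its walls, the
vertices opposite to ridges on the slab's boundary, and B = σ \ A. The facets are W \ z, with z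
running either through A or through B ∪ {o}; both options triangulate a ball with boundary ∂A * ∂(B
∪ {o}). On the diagonals F_σ = A and G_σ = B, so these are the two permitted choices. For the other
cells z runs through A, which gives the cones over the connecting faces. A slab that is one simplex
has B = ∅ and takes z = o. The cone with the last vertex has the same form, with walls taken
relative to the whole box. See `sphere_eq_gen`.

Cells are added by index sum, ties broken lexicographically, and the cone over the boundary comes
last, in the same order. Suppose the earlier facets meet the ball of σ in the ridges W \ {x, y} with
x ∈ A, y ∈ B ∪ {o} and P x y. If the neighbourhoods of P are nested (a Ferrers relation), adding the
facets W \ z by decreasing neighbourhood of z continues the shelling. Being Ferrers is symmetric in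
the two sides, so both triangulations are handled at once (`Shelled.attach_cell`). The relation P is
found in `Shelled.attach_low`, `Shelled.attach_not_low` and `Shelled.attach_apex`, with
`exists_neighbor` supplying the cell across a ridge.

The slab width d + 2 matters because changing each of d indices by at most 1 changes the sum by at
most d, too little to get from one diagonal of a slab to the other. -/

namespace NSW

/-! ### Complexes generated by equicardinal families; boundaries, cones and joins. -/

section Generated

variable {V : Type*}

/-- The complex generated by a family of faces. -/
def gen (S : Set (Finset V)) : SComplex V where
  carrier := {H | ∃ F ∈ S, H ⊆ F}
  lower' := by
    rintro G G' hle ⟨F, hF, h⟩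
    exact ⟨F, hF, subset_trans hle h⟩

theorem mem_gen {S : Set (Finset V)} {H : Finset V} : H ∈ gen S ↔ ∃ F ∈ S, H ⊆ F := Iff.rfl

theorem mem_simplex {F H : Finset V} : H ∈ simplex F ↔ H ⊆ F := Iff.rfl

theorem gen_singleton (F : Finset V) : gen {F} = simplex F := by
  refine SetLike.ext fun H => ?_
  simp [mem_gen, mem_simplex]

theorem gen_union (S T : Set (Finset V)) : gen (S ∪ T) = gen S ⊔ gen T := by
  refine SetLike.ext fun H => ?_
  simp only [LowerSet.mem_sup_iff, mem_gen, Set.mem_union, or_and_right, exists_or]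

theorem gen_insert (F : Finset V) (S : Set (Finset V)) : gen (insert F S) = gen S ⊔ simplex F := by
  rw [Set.insert_eq, Set.union_comm, gen_union, gen_singleton]

theorem isFacet_gen {S : Set (Finset V)} {N : ℕ} (hS : ∀ F ∈ S, F.card = N) {G : Finset V} :
    IsFacet (gen S) G ↔ G ∈ S := by
  constructor
  · rintro ⟨⟨F, hF, hGF⟩, hmax⟩
    have : F ⊆ G := hmax ⟨F, hF, subset_rfl⟩ hGF
    rwa [subset_antisymm hGF this]
  · intro hG
    refine ⟨⟨G, hG, subset_rfl⟩, ?_⟩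
    rintro H ⟨F, hF, hHF⟩ hGH
    have : G = F := Finset.eq_of_subset_of_card_le (subset_trans hGH hHF) (by rw [hS F hF, hS G hG])
    exact this ▸ hHF

theorem isPure_gen {S : Set (Finset V)} {N : ℕ} (hS : ∀ F ∈ S, F.card = N) (hne : S.Nonempty) :
    IsPure ((N : ℤ) - 1) (gen S) := by
  refine ⟨?_, ?_, ?_⟩
  · obtain ⟨F, hF⟩ := hne
    exact ⟨F, F, hF, subset_rfl⟩
  · rintro F ⟨G, hG, hFG⟩
    exact ⟨G, (isFacet_gen hS).2 hG, hFG⟩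
  · intro G hG
    rw [hS G ((isFacet_gen hS).1 hG)]

theorem mem_boundary_gen {S : Set (Finset V)} {N : ℕ} (hS : ∀ F ∈ S, F.card = N) {G : Finset V} :
    G ∈ boundary (gen S) ↔
      ∃ H, ∃ F ∈ S, G ⊆ H ∧ H ⊆ F ∧ H.card + 1 = F.card ∧ ∀ F' ∈ S, H ⊆ F' → F' = F := by
  constructor
  · rintro ⟨H, F, hGH, hF, hHF, hc, hu⟩
    exact ⟨H, F, (isFacet_gen hS).1 hF, hGH, hHF, hc,
      fun F' hF' => hu F' ((isFacet_gen hS).2 hF')⟩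
  · rintro ⟨H, F, hF, hGH, hHF, hc, hu⟩
    exact ⟨H, F, hGH, (isFacet_gen hS).2 hF, hHF, hc,
      fun F' hF' => hu F' ((isFacet_gen hS).1 hF')⟩

variable [DecidableEq V]

theorem exists_erase_of_card_succ {H F : Finset V} (h : H ⊆ F) (hc : H.card + 1 = F.card) :
    ∃ v ∈ F, H = F.erase v := by
  have h1 : (F \ H).card = 1 := by
    rw [Finset.card_sdiff_of_subset h]
    omega
  obtain ⟨v, hv⟩ := Finset.card_eq_one.1 h1
  have hvm : v ∈ F \ H := by simp [hv]
  refine ⟨v, (Finset.mem_sdiff.1 hvm).1, ?_⟩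
  rw [Finset.erase_eq, ← hv, Finset.sdiff_sdiff_eq_self h]

theorem mem_boundary_simplex {A H : Finset V} :
    H ∈ boundary (simplex A) ↔ ∃ a ∈ A, H ⊆ A.erase a := by
  rw [← gen_singleton, mem_boundary_gen (N := A.card) (by simp)]
  constructor
  · rintro ⟨G, F, rfl, hHG, hGF, hc, -⟩
    obtain ⟨a, ha, rfl⟩ := exists_erase_of_card_succ hGF hc
    exact ⟨a, ha, hHG⟩
  · rintro ⟨a, ha, h⟩
    exact ⟨A.erase a, A, rfl, h, Finset.erase_subset _ _, Finset.card_erase_add_one ha,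
      fun F' hF' _ => hF'⟩

theorem cone_simplex (A : Finset V) (v : V) : cone (simplex A) v = simplex (insert v A) := by
  refine SetLike.ext fun H => ?_
  constructor
  · rintro ⟨F, hF, G, hG, rfl⟩
    rw [mem_simplex] at *
    exact Finset.union_subset (hF.trans (Finset.subset_insert _ _))
      (hG.trans (by simp))
  · intro h
    rw [mem_simplex] at h
    refine ⟨H ∩ A, Finset.inter_subset_right, H ∩ {v}, Finset.inter_subset_right, ?_⟩
    rw [← Finset.inter_union_distrib_left]
    refine (Finset.inter_eq_left.2 (h.trans ?_)).symm
    rw [Finset.union_comm, ← Finset.insert_eq]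

theorem cone_gen (S : Set (Finset V)) (v : V) : cone (gen S) v = gen (insert v '' S) := by
  refine SetLike.ext fun H => ?_
  constructor
  · rintro ⟨F, ⟨F', hF', hF⟩, G, hG, rfl⟩
    have : F ∪ G ∈ simplex (insert v F') := by
      rw [← cone_simplex]
      exact ⟨F, hF, G, hG, rfl⟩
    exact ⟨insert v F', ⟨F', hF', rfl⟩, this⟩
  · rintro ⟨_, ⟨F', hF', rfl⟩, h⟩
    have h' : H ∈ cone (simplex F') v := by rw [cone_simplex]; exact h
    obtain ⟨F, hF, G, hG, rfl⟩ := h'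
    exact ⟨F, ⟨F', hF', hF⟩, G, hG, rfl⟩

theorem mem_join_boundary {A B H : Finset V} (hd : Disjoint A B) :
    H ∈ join (simplex A) (boundary (simplex B)) ↔ ∃ b ∈ B, H ⊆ (A ∪ B).erase b := by
  constructor
  · rintro ⟨F, hF, G, hG, rfl⟩
    obtain ⟨b, hb, hGb⟩ := mem_boundary_simplex.1 hG
    refine ⟨b, hb, ?_⟩
    intro x hx
    rcases Finset.mem_union.1 hx with h | h
    · have hxA := mem_simplex.1 hF h
      exact Finset.mem_erase.2 ⟨fun e => Finset.disjoint_left.1 hd hxA (e ▸ hb),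
        Finset.mem_union_left _ hxA⟩
    · have := Finset.mem_erase.1 (hGb h)
      exact Finset.mem_erase.2 ⟨this.1, Finset.mem_union_right _ this.2⟩
  · rintro ⟨b, hb, h⟩
    have h' := h.trans (Finset.erase_subset _ _)
    refine ⟨H ∩ A, Finset.inter_subset_right, H ∩ B, ?_, ?_⟩
    · refine mem_boundary_simplex.2 ⟨b, hb, fun x hx => ?_⟩
      have hx := Finset.mem_inter.1 hx
      exact Finset.mem_erase.2 ⟨(Finset.mem_erase.1 (h hx.1)).1, hx.2⟩
    · rw [← Finset.inter_union_distrib_left]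
      exact (Finset.inter_eq_left.2 h').symm

theorem join_comm (Δ Γ : SComplex V) : join Δ Γ = join Γ Δ := by
  refine SetLike.ext fun H => ?_
  constructor
  · rintro ⟨F, hF, G, hG, rfl⟩
    exact ⟨G, hG, F, hF, Finset.union_comm _ _⟩
  · rintro ⟨F, hF, G, hG, rfl⟩
    exact ⟨G, hG, F, hF, Finset.union_comm _ _⟩

/-! ### Shellings, constructibility, and attaching balls along Ferrers relations. -/

/-- Families of `N`-sets that can be listed in a shelling order. -/
inductive Shelled (N : ℕ) : Set (Finset V) → Prop
  | empty : Shelled N ∅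
  | addFacet {S : Set (Finset V)} {F : Finset V} : Shelled N S → F.card = N →
      (∀ F' ∈ S, ∃ F'' ∈ S, ∃ v ∈ F, v ∉ F' ∧ F.erase v ⊆ F'') → Shelled N (insert F S)

theorem Shelled.card_eq {N : ℕ} {S : Set (Finset V)} (h : Shelled N S) : ∀ F ∈ S, F.card = N := by
  induction h with
  | empty => simp
  | addFacet _ hc _ ih =>
    rintro G (rfl | hG)
    exacts [hc, ih G hG]

/-- If `F` can be added to the shelled family `S`, then it meets the complex generated by `S` in the
ridges of `F` that are covered by `S`. -/
theorem simplex_inf_gen {S : Set (Finset V)} {F : Finset V}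
    (h : ∀ F' ∈ S, ∃ F'' ∈ S, ∃ v ∈ F, v ∉ F' ∧ F.erase v ⊆ F'') :
    simplex F ⊓ gen S = gen (F.erase '' {v | v ∈ F ∧ ∃ F'' ∈ S, F.erase v ⊆ F''}) := by
  refine SetLike.ext fun H => ?_
  constructor
  · rintro ⟨hF, F', hF', hH⟩
    obtain ⟨F'', hF'', v, hv, hvF', hsub⟩ := h F' hF'
    refine ⟨F.erase v, ⟨v, ⟨hv, F'', hF'', hsub⟩, rfl⟩, ?_⟩
    exact Finset.subset_erase.2 ⟨hF, fun hvH => hvF' (hH hvH)⟩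
  · rintro ⟨_, ⟨v, ⟨hv, F'', hF'', hsub⟩, rfl⟩, hH⟩
    exact ⟨hH.trans (Finset.erase_subset _ _), F'', hF'', hH.trans hsub⟩

theorem isPure_simplex_inf_gen {S : Set (Finset V)} {F : Finset V} (hS : S.Nonempty)
    (h : ∀ F' ∈ S, ∃ F'' ∈ S, ∃ v ∈ F, v ∉ F' ∧ F.erase v ⊆ F'') :
    IsPure ((F.card : ℤ) - 1 - 1) (simplex F ⊓ gen S) := by
  obtain ⟨F', hF'⟩ := hS
  obtain ⟨F'', hF'', v, hv, -, hsub⟩ := h F' hF'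
  have hpos : 0 < F.card := Finset.card_pos.2 ⟨v, hv⟩
  have := isPure_gen (S := F.erase '' {v | v ∈ F ∧ ∃ F'' ∈ S, F.erase v ⊆ F''}) (N := F.card - 1)
    (by rintro _ ⟨w, hw, rfl⟩; exact Finset.card_erase_of_mem hw.1)
    ⟨_, v, ⟨hv, F'', hF'', hsub⟩, rfl⟩
  rw [simplex_inf_gen h]
  convert this using 1
  omega

/-- Induct on `R`: the ridge opposite to a new vertex `a` meets the earlier ridges in the complex of
the same kind inside `F.erase a`, so the induction must allow every `F`. -/
theorem isConstructible_gen_erase (R : Finset V) (hR : R.Nonempty) :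
    ∀ F : Finset V, R ⊆ F → IsConstructible ((F.card : ℤ) - 2) (gen (F.erase '' (R : Set V))) := by
  induction hR using Finset.Nonempty.cons_induction with
  | singleton a =>
    intro F hF
    have ha : a ∈ F := by simpa using hF
    have hc := Finset.card_erase_add_one ha
    have := IsConstructible.ofSimplex (F.erase a)
    rw [Finset.coe_singleton, Set.image_singleton, gen_singleton]
    convert this using 1
    omega
  | cons a R haR hR ih =>
    intro F hF
    have ha : a ∈ F := hF (by simp)
    have hRF : R ⊆ F := fun x hx => hF (by simp [hx])
    have hc := Finset.card_erase_add_one ha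
    rw [Finset.coe_cons, Set.image_insert_eq, gen_insert]
    refine IsConstructible.glue (ih F hRF) ?_ ?_
    · convert IsConstructible.ofSimplex (F.erase a) using 1
      omega
    · have h1 := ih (F.erase a) (Finset.subset_erase.2 ⟨hRF, haR⟩)
      have h2 : gen (F.erase '' (R : Set V)) ⊓ simplex (F.erase a) =
          gen ((F.erase a).erase '' (R : Set V)) := by
        refine SetLike.ext fun H => ?_
        constructor
        · rintro ⟨⟨_, ⟨v, hv, rfl⟩, hH⟩, hHa⟩
          refine ⟨_, ⟨v, hv, rfl⟩, Finset.subset_erase.2 ⟨hHa, ?_⟩⟩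
          exact (Finset.subset_erase.1 hH).2
        · rintro ⟨_, ⟨v, hv, rfl⟩, hH⟩
          refine ⟨⟨_, ⟨v, hv, rfl⟩, hH.trans ?_⟩, hH.trans (Finset.erase_subset _ _)⟩
          exact Finset.erase_subset_erase _ (Finset.erase_subset _ _)
      rw [h2]
      convert h1 using 1
      omega

theorem Shelled.isConstructible {N : ℕ} {S : Set (Finset V)} (h : Shelled N S)
    (hne : S.Nonempty) : IsConstructible ((N : ℤ) - 1) (gen S) := by
  induction h with
  | empty => simp at hne
  | @addFacet S F hS hc hF ih =>
    rcases S.eq_empty_or_nonempty with rfl | hne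
    · rw [insert_empty_eq, gen_singleton, ← hc]
      exact IsConstructible.ofSimplex F
    · rw [gen_insert]
      refine IsConstructible.glue (ih hne) (hc ▸ IsConstructible.ofSimplex F) ?_
      rw [inf_comm, simplex_inf_gen hF]
      classical
      have := isConstructible_gen_erase (F.filter fun v => ∃ F'' ∈ S, F.erase v ⊆ F'') (by
        obtain ⟨F', hF'⟩ := hne
        obtain ⟨F'', hF'', v, hv, -, hsub⟩ := hF F' hF'
        exact ⟨v, Finset.mem_filter.2 ⟨hv, F'', hF'', hsub⟩⟩) F (Finset.filter_subset _ _)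
      rw [Finset.coe_filter, hc] at this
      convert this using 1
      ring

/-- The enumeration is a function on ℕ, so that appending a facet is a `Function.update` that leaves
the initial segments unchanged. -/
theorem Shelled.exists_enumeration {N : ℕ} {S : Set (Finset V)} (h : Shelled N S) :
    ∃ (m : ℕ) (F : ℕ → Finset V), Set.InjOn F (Set.Iio m) ∧ F '' Set.Iio m = S ∧
      ∀ j < m, ∀ F' ∈ F '' Set.Iio j, ∃ F'' ∈ F '' Set.Iio j, ∃ v ∈ F j,
        v ∉ F' ∧ (F j).erase v ⊆ F'' := by
  induction h with
  | empty => exact ⟨0, fun _ => ∅, by simp, by simp, by simp⟩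
  | @addFacet S G hS hc hG ih =>
    obtain ⟨m, F, hinj, himg, hF⟩ := ih
    have hGS : G ∉ S := fun hmem => by
      obtain ⟨_, _, v, hv, hv', _⟩ := hG G hmem
      exact hv' hv
    have hlt : ∀ j ≤ m, Function.update F m G '' Set.Iio j = F '' Set.Iio j := by
      intro j hj
      refine Set.image_congr fun x hx => ?_
      have hx : x < j := hx
      rw [Function.update_of_ne (by omega)]
    refine ⟨m + 1, Function.update F m G, ?_, ?_, ?_⟩
    · have hI : Set.Iio (m + 1) = insert m (Set.Iio m) := by ext x; simp
      rw [hI, Set.injOn_insert (by simp)]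
      refine ⟨fun x hx y hy hxy => hinj hx hy ?_, ?_⟩
      · have hx' : x < m := hx
        have hy' : y < m := hy
        rwa [Function.update_of_ne (by omega), Function.update_of_ne (by omega)] at hxy
      · rw [hlt m le_rfl, Function.update_self, himg]
        exact hGS
    · have hI : Set.Iio (m + 1) = insert m (Set.Iio m) := by ext x; simp
      rw [hI, Set.image_insert_eq, hlt m le_rfl, Function.update_self, himg]
    · intro j hj
      rw [hlt j (by omega)]
      rcases Nat.lt_succ_iff_lt_or_eq.1 hj with hj | rfl
      · rw [Function.update_of_ne (by omega)]
        exact hF j hj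
      · rw [Function.update_self, himg]
        exact hG

theorem Shelled.isShellable {N : ℕ} {S : Set (Finset V)} (h : Shelled N S)
    (hne : S.Nonempty) : IsShellable ((N : ℤ) - 1) (gen S) := by
  have hcard := h.card_eq
  obtain ⟨m, F, hinj, himg, hF⟩ := h.exists_enumeration
  refine ⟨isPure_gen hcard hne, m, fun j => F j, ?_, ?_, ?_⟩
  · intro x y hxy
    exact Fin.ext (hinj x.2 y.2 hxy)
  · intro G
    rw [isFacet_gen hcard, ← himg]
    constructor
    · rintro ⟨j, hj, rfl⟩
      exact ⟨⟨j, hj⟩, rfl⟩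
    · rintro ⟨j, rfl⟩
      exact ⟨j, j.2, rfl⟩
  · intro j hj
    have hgen : (⨆ (i : Fin m) (_ : i < j), simplex (F i)) = gen (F '' Set.Iio (j : ℕ)) := by
      refine SetLike.ext fun H => ?_
      simp only [LowerSet.mem_iSup_iff, mem_simplex, mem_gen]
      constructor
      · rintro ⟨i, hi, h⟩
        exact ⟨F i, ⟨i, hi, rfl⟩, h⟩
      · rintro ⟨_, ⟨i, hi, rfl⟩, h⟩
        exact ⟨⟨i, lt_trans hi j.2⟩, hi, h⟩
    rw [hgen]
    have := isPure_simplex_inf_gen (Set.Nonempty.image F ⟨0, hj⟩) (hF j j.2)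
    rwa [hcard (F j) (himg ▸ ⟨j, j.2, rfl⟩)] at this

/-- Attaching facets of the boundary of the simplex `W` to a shelled family: if the previous facets
meet the ball in the ridges `W \ {x, y}` with `P x y`, and `P` is a Ferrers relation, then
the facets `W \ {x}`, `x ∈ A`, can be added. -/
theorem Shelled.attach {N : ℕ} {S : Set (Finset V)} (hS : Shelled N S) {W : Finset V}
    (hW : W.card = N + 1) (P : V → V → Prop) (A : Finset V) (hAW : A ⊆ W)
    (hP : ∀ x ∈ A, ∀ y, P x y → y ∈ W ∧ y ≠ x ∧ ∃ F' ∈ S, (W.erase x).erase y ⊆ F')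
    (hmeet : ∀ F' ∈ S, ∀ z ∈ A, ∃ x ∈ A, ∃ y, P x y ∧ (x ∉ F' ∨ x = z) ∧ y ∉ F')
    (hferrers : ∀ x ∈ A, ∀ x' ∈ A, ∀ y y', P x y → P x' y' → P x y' ∨ P x' y) :
    Shelled N (S ∪ W.erase '' (A : Set V)) := by
  induction hn : A.card generalizing A with
  | zero =>
    rw [Finset.card_eq_zero.1 hn]
    simpa using hS
  | succ n ih =>
    have hne : A.Nonempty := Finset.card_pos.1 (by omega)
    -- The Ferrers condition makes the neighbourhoods `{y | P x y}` a chain; the facet opposite to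
    -- the `x` with the smallest one is added last.
    obtain ⟨a, ha, hmin⟩ : ∃ a ∈ A, ∀ x ∈ A, ∀ y, P a y → P x y := by
      obtain ⟨a, haA, hamin⟩ := Finset.exists_minimalFor (fun x => {y | P x y}) A hne
      refine ⟨a, haA, fun x hx y hy => ?_⟩
      by_contra hxy
      have hle : {y | P x y} ⊆ {y | P a y} := fun y' hy' =>
        (hferrers a haA x hx y y' hy hy').resolve_right hxy
      exact hxy (hamin hx hle hy)
    have hB : ∀ x ∈ A.erase a, x ∈ A := fun x => Finset.mem_of_mem_erase
    have hsh := ih (A.erase a) ((Finset.erase_subset _ _).trans hAW)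
      (fun x hx => hP x (hB x hx))
      (fun F' hF' z hz => by
        obtain ⟨x, hx, y, hxy, h1, h2⟩ := hmeet F' hF' z (hB z hz)
        -- A witness `a` is no longer available, but minimality of its neighbourhood lets `z` take
        -- its place.
        by_cases hxa : x = a
        · subst hxa
          exact ⟨z, hz, y, hmin z (hB z hz) y hxy, Or.inr rfl, h2⟩
        · exact ⟨x, Finset.mem_erase.2 ⟨hxa, hx⟩, y, hxy, h1, h2⟩)
      (fun x hx x' hx' => hferrers x (hB x hx) x' (hB x' hx'))
      (by rw [Finset.card_erase_of_mem ha]; omega)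
    have := hsh.addFacet (F := W.erase a) (by rw [Finset.card_erase_of_mem (hAW ha)]; omega) (by
      have key : ∀ x ∈ A.erase a, W.erase x ∈ S ∪ W.erase '' ((A.erase a : Finset V) : Set V) :=
        fun x hx => Or.inr ⟨x, hx, rfl⟩
      have hcomm : ∀ x, (W.erase a).erase x ⊆ W.erase x :=
        fun x => Finset.erase_subset_erase _ (Finset.erase_subset _ _)
      rintro F' (hF' | ⟨x, hx, rfl⟩)
      · obtain ⟨x, hx, y, hxy, h1, h2⟩ := hmeet F' hF' a ha
        -- If `x = a`, the required ridge lies in an old facet by `hP`; otherwise it lies in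
        -- `W.erase x`, which has just been added.
        by_cases hxa : x = a
        · subst hxa
          obtain ⟨hyW, hyx, F'', hF'', hsub⟩ := hP x hx y hxy
          exact ⟨F'', Or.inl hF'', y, Finset.mem_erase.2 ⟨hyx, hyW⟩, h2, hsub⟩
        · exact ⟨_, key x (Finset.mem_erase.2 ⟨hxa, hx⟩), x, Finset.mem_erase.2 ⟨hxa, hAW hx⟩,
            h1.resolve_right hxa, hcomm x⟩
      · have hx' := Finset.mem_erase.1 hx
        exact ⟨_, key x hx, x, Finset.mem_erase.2 ⟨hx'.1, hAW hx'.2⟩, by simp, hcomm x⟩)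
    rw [← Finset.insert_erase ha, Finset.coe_insert, Set.image_insert_eq, Set.union_insert]
    exact this

/-- Attaching finitely many groups of facets, in the order of an injective key. -/
theorem Shelled.extend {N : ℕ} {ι κ : Type*} [LinearOrder κ] [DecidableEq ι]
    {key : ι → κ} (hkey : Function.Injective key) (C : ι → Set (Finset V))
    {S : Set (Finset V)} (hS : Shelled N S) (t : Finset ι)
    (h : ∀ i ∈ t, Shelled N (S ∪ {F | ∃ j ∈ t, key j < key i ∧ F ∈ C j}) →
      Shelled N (S ∪ {F | ∃ j ∈ t, key j < key i ∧ F ∈ C j} ∪ C i)) :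
    Shelled N (S ∪ {F | ∃ j ∈ t, F ∈ C j}) := by
  induction t using Finset.induction_on_max_value key with
  | empty => simpa using hS
  | insert a t hat hmax ih =>
    have hlt : ∀ j ∈ t, key j < key a := fun j hj =>
      lt_of_le_of_ne (hmax j hj) (fun e => hat (hkey e ▸ hj))
    have h1 : ∀ i ∈ t, {F | ∃ j ∈ insert a t, key j < key i ∧ F ∈ C j} =
        {F | ∃ j ∈ t, key j < key i ∧ F ∈ C j} := by
      intro i hi
      ext F
      constructor
      · rintro ⟨j, hj, hji, hF⟩
        rcases Finset.mem_insert.1 hj with rfl | hj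
        · exact absurd hji (hlt i hi).not_gt
        · exact ⟨j, hj, hji, hF⟩
      · rintro ⟨j, hj, hji, hF⟩
        exact ⟨j, Finset.mem_insert_of_mem hj, hji, hF⟩
    have h2 : {F | ∃ j ∈ insert a t, key j < key a ∧ F ∈ C j} = {F | ∃ j ∈ t, F ∈ C j} := by
      ext F
      constructor
      · rintro ⟨j, hj, hja, hF⟩
        rcases Finset.mem_insert.1 hj with rfl | hj
        · exact absurd hja (lt_irrefl _)
        · exact ⟨j, hj, hF⟩
      · rintro ⟨j, hj, hF⟩
        exact ⟨j, Finset.mem_insert_of_mem hj, hlt j hj, hF⟩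
    have h3 : S ∪ {F | ∃ j ∈ insert a t, F ∈ C j} = S ∪ {F | ∃ j ∈ t, F ∈ C j} ∪ C a := by
      ext F
      simp only [Set.mem_union, Set.mem_ofPred_eq, Finset.mem_insert, exists_eq_or_imp]
      rw [or_assoc]
      exact or_congr_right or_comm
    have ih := ih fun i hi => by
      have := h i (Finset.mem_insert_of_mem hi)
      rwa [h1 i hi] at this
    have := h a (Finset.mem_insert_self _ _)
    rw [h2] at this
    rw [h3]
    exact this ih

end Generated


/-! ### Cells of the join, adjacency, and the shelling order. -/

section Cells

variable {d : ℕ}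

/-- The two vertices of the cell `i` on the path `l`. -/
def vt (i : Fin d → ℕ) (l : Fin d) (e : Bool) : Vertex d := Vertex.a l (i l + e.toNat)

/-- The cell on the other side of the ridge opposite to `vt i l e`. -/
def step (i : Fin d → ℕ) (l : Fin d) (e : Bool) : Fin d → ℕ :=
  Function.update i l (if e then i l - 1 else i l + 1)

theorem vt_eq_vt {i j : Fin d → ℕ} {l m : Fin d} {e f : Bool} :
    vt i l e = vt j m f ↔ l = m ∧ i l + e.toNat = j m + f.toNat := by
  simp [vt]

theorem step_apply (i : Fin d → ℕ) (l : Fin d) (e : Bool) (m : Fin d) :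
    step i l e m = if m = l then (if e then i l - 1 else i l + 1) else i m := by
  by_cases h : m = l
  · subst h; simp [step]
  · simp [step, h]

theorem a_mem_cell {i : Fin d → ℕ} {l : Fin d} {p : ℕ} :
    Vertex.a l p ∈ cell i ↔ p = i l ∨ p = i l + 1 := by
  simp only [cell, Finset.mem_biUnion, Finset.mem_univ, true_and, Finset.mem_insert,
    Finset.mem_singleton, Vertex.a.injEq]
  constructor
  · rintro ⟨a, ⟨rfl, h⟩ | ⟨rfl, h⟩⟩
    exacts [Or.inl h, Or.inr h]
  · rintro (h | h)
    exacts [⟨l, Or.inl ⟨rfl, h⟩⟩, ⟨l, Or.inr ⟨rfl, h⟩⟩]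

theorem vt_mem_cell {i j : Fin d → ℕ} {l : Fin d} {e : Bool} :
    vt i l e ∈ cell j ↔ i l + e.toNat = j l ∨ i l + e.toNat = j l + 1 := a_mem_cell

theorem o_notMem_cell {i : Fin d → ℕ} {k : ℕ} : Vertex.o k ∉ cell i := by
  simp [cell]

theorem apex_notMem_cell {i : Fin d → ℕ} : Vertex.apex ∉ cell i := by
  simp [cell]

theorem mem_cell {i : Fin d → ℕ} {v : Vertex d} : v ∈ cell i ↔ ∃ l e, v = vt i l e := by
  constructor
  · intro h
    cases v with
    | a l p =>
      rcases a_mem_cell.1 h with rfl | rfl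
      exacts [⟨l, false, rfl⟩, ⟨l, true, rfl⟩]
    | o k => exact absurd h o_notMem_cell
    | apex => exact absurd h apex_notMem_cell
  · rintro ⟨l, e, rfl⟩
    cases e <;> simp [vt_mem_cell]

theorem vt_mem_self (i : Fin d → ℕ) (l : Fin d) (e : Bool) : vt i l e ∈ cell i :=
  mem_cell.2 ⟨l, e, rfl⟩

theorem vt_injective (i : Fin d → ℕ) :
    Function.Injective fun p : Fin d × Bool => vt i p.1 p.2 := by
  rintro ⟨l, e⟩ ⟨m, f⟩ h
  obtain ⟨h1, h2⟩ := vt_eq_vt.1 h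
  simp only at h1 h2
  subst h1
  cases e <;> cases f <;> simp at h2 ⊢

theorem vt_inj {i : Fin d → ℕ} {l m : Fin d} {e f : Bool} :
    vt i l e = vt i m f ↔ l = m ∧ e = f := by
  constructor
  · intro h
    simpa using vt_injective i (a₁ := (l, e)) (a₂ := (m, f)) h
  · rintro ⟨rfl, rfl⟩
    rfl

theorem cell_eq_image (i : Fin d → ℕ) :
    cell i = (Finset.univ : Finset (Fin d × Bool)).image fun p => vt i p.1 p.2 := by
  ext v
  rw [mem_cell]
  simp [eq_comm]

theorem card_cell (i : Fin d → ℕ) : (cell i).card = 2 * d := by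
  rw [cell_eq_image, Finset.card_image_of_injective _ (vt_injective i)]
  simp [mul_comm]

theorem eq_of_cell_subset {i j : Fin d → ℕ} (h : cell i ⊆ cell j) : i = j := by
  funext l
  have h0 := vt_mem_cell.1 (h (vt_mem_self i l false))
  have h1 := vt_mem_cell.1 (h (vt_mem_self i l true))
  simp at h0 h1
  omega

/-- On every path other than `l` both vertices survive and fix the edge; the one vertex left on path
`l` lies on only two edges. -/
theorem eq_or_eq_step {i j : Fin d → ℕ} {l : Fin d} {e : Bool}
    (h : (cell i).erase (vt i l e) ⊆ cell j) : j = i ∨ j = step i l e := by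
  have hm : ∀ m, m ≠ l → j m = i m := by
    intro m hm
    have h0 := vt_mem_cell.1 (h (Finset.mem_erase.2
      ⟨fun e => hm (vt_inj.1 e).1, vt_mem_self i m false⟩))
    have h1 := vt_mem_cell.1 (h (Finset.mem_erase.2
      ⟨fun e => hm (vt_inj.1 e).1, vt_mem_self i m true⟩))
    simp at h0 h1
    omega
  have hl := vt_mem_cell.1 (h (Finset.mem_erase.2
      ⟨fun e' => by simp [vt_inj] at e', vt_mem_self i l (!e)⟩))
  have hl' : j l = i l ∨ j l = step i l e l := by
    rw [step_apply, if_pos rfl]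
    cases e <;> (simp at hl ⊢; omega)
  refine hl'.imp (fun hl => funext fun m => ?_) (fun hl => funext fun m => ?_) <;>
    by_cases hml : m = l
  · rw [hml, hl]
  · exact hm m hml
  · rw [hml, hl]
  · rw [hm m hml, step_apply, if_neg hml]

theorem cell_erase_subset_step {i : Fin d → ℕ} {l : Fin d} {e : Bool} (hi : 1 ≤ i l) :
    (cell i).erase (vt i l e) ⊆ (cell (step i l e)).erase (vt (step i l e) l (!e)) := by
  intro v hv
  obtain ⟨hne, hv⟩ := Finset.mem_erase.1 hv
  obtain ⟨m, f, rfl⟩ := mem_cell.1 hv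
  rw [Finset.mem_erase, vt_mem_cell, Ne, vt_eq_vt, step_apply, step_apply]
  rw [Ne, vt_inj] at hne
  by_cases hm : m = l
  · subst hm
    cases e <;> cases f <;> simp at hne ⊢ <;> omega
  · cases f <;> simp [hm]

theorem step_ne {i : Fin d → ℕ} {l : Fin d} {e : Bool} (hi : 1 ≤ i l) : step i l e ≠ i := by
  intro h
  have := congrFun h l
  rw [step_apply, if_pos rfl] at this
  cases e <;> simp at this
  omega

theorem step_step {i : Fin d → ℕ} {l : Fin d} {e : Bool} (hi : 1 ≤ i l) :
    step (step i l e) l (!e) = i := by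
  funext m
  simp only [step_apply]
  by_cases hm : m = l
  · subst hm
    cases e <;> simp
    omega
  · simp [hm]

theorem step_comm {i : Fin d → ℕ} {l l' : Fin d} {e e' : Bool} (h : l ≠ l') :
    step (step i l e) l' e' = step (step i l' e') l e := by
  funext m
  simp only [step_apply]
  by_cases hm : m = l
  · subst hm
    simp [h]
  · by_cases hm' : m = l'
    · subst hm'
      simp [hm]
    · simp [hm, hm']

theorem sum_step_false (i : Fin d → ℕ) (l : Fin d) :
    ∑ m, step i l false m = ∑ m, i m + 1 := by
  have h := Finset.add_sum_erase Finset.univ i (Finset.mem_univ l)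
  rw [step, Finset.sum_update_of_mem (Finset.mem_univ l), ← Finset.erase_eq]
  simp only [Bool.false_eq_true, if_false]
  omega

theorem sum_step_true {i : Fin d → ℕ} {l : Fin d} (hi : 1 ≤ i l) :
    ∑ m, step i l true m + 1 = ∑ m, i m := by
  rw [← sum_step_false (step i l true) l, ← Bool.not_true, step_step hi]

/-- The order in which the cells are shelled: by index sum, then lexicographically. -/
def key (i : Fin d → ℕ) : ℕ ×ₗ Lex (Fin d → ℕ) := toLex (∑ l, i l, toLex i)

theorem key_injective : Function.Injective (key (d := d)) := by
  intro i j h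
  have : (∑ l, i l, toLex i) = (∑ l, j l, toLex j) := toLex.injective h
  exact toLex.injective (Prod.ext_iff.1 this).2

theorem key_lt_key {j i : Fin d → ℕ} : key j < key i ↔ ∑ l, j l < ∑ l, i l ∨
    (∑ l, j l = ∑ l, i l ∧ ∃ l, (∀ m < l, j m = i m) ∧ j l < i l) :=
  Prod.Lex.lt_iff

theorem exists_lt_of_key_lt {j i : Fin d → ℕ} (h : key j < key i) : ∃ l, j l < i l := by
  rcases key_lt_key.1 h with h | ⟨_, l, -, hl⟩
  · obtain ⟨l, -, hl⟩ := Finset.exists_lt_of_sum_lt h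
    exact ⟨l, hl⟩
  · exact ⟨l, hl⟩

/-- The first differing index is smaller in `j`; with equal sums, a later index has to compensate.
-/
theorem exists_lt_gt_of_key_lt {j i : Fin d → ℕ} (h : key j < key i)
    (hs : ∑ l, j l = ∑ l, i l) : ∃ l' l, l' < l ∧ j l' < i l' ∧ i l < j l := by
  rcases key_lt_key.1 h with h | ⟨_, l', hm, hl⟩
  · omega
  · by_contra! hcon
    have : ∑ l, j l < ∑ l, i l := Finset.sum_lt_sum (fun m _ => by
      rcases lt_trichotomy m l' with h | rfl | h
      · exact (hm m h).le
      · exact hl.le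
      · exact hcon l' m h hl) ⟨l', Finset.mem_univ _, hl⟩
    omega

/-- The vertices of the cell `i` opposite to the ridges on the boundary of the family `Q`. -/
def walls (Q : Finset (Fin d → ℕ)) (i : Fin d → ℕ) : Finset (Vertex d) :=
  ((Finset.univ : Finset (Fin d × Bool)).filter fun p => step i p.1 p.2 ∉ Q).image
    fun p => vt i p.1 p.2

theorem mem_walls {Q : Finset (Fin d → ℕ)} {i : Fin d → ℕ} {v : Vertex d} :
    v ∈ walls Q i ↔ ∃ l e, step i l e ∉ Q ∧ v = vt i l e := by
  simp [walls, eq_comm]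

theorem vt_mem_walls {Q : Finset (Fin d → ℕ)} {i : Fin d → ℕ} {l : Fin d} {e : Bool} :
    vt i l e ∈ walls Q i ↔ step i l e ∉ Q := by
  rw [mem_walls]
  constructor
  · rintro ⟨m, f, h, hm⟩
    obtain ⟨rfl, rfl⟩ := vt_inj.1 hm
    exact h
  · intro h
    exact ⟨l, e, h, rfl⟩

theorem walls_subset_cell (Q : Finset (Fin d → ℕ)) (i : Fin d → ℕ) : walls Q i ⊆ cell i := by
  intro v hv
  obtain ⟨l, e, -, rfl⟩ := mem_walls.1 hv
  exact vt_mem_self i l e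

/-- In a convex family of cells, every codimension-two face opposite to a wall and a non-wall of
a cell lies in another such face of another cell. -/
theorem exists_neighbor {Q : Finset (Fin d → ℕ)} (hQ : (Q : Set (Fin d → ℕ)).OrdConnected)
    (hpos : ∀ j ∈ Q, ∀ l, 1 ≤ j l) {i : Fin d → ℕ} (hi : i ∈ Q) {l l' : Fin d} {e e' : Bool}
    (hx : step i l e ∉ Q) (hy : step i l' e' ∈ Q) :
    ∃ j ∈ Q, j ≠ i ∧
      (∃ x ∈ walls Q j, ∃ y ∈ cell j \ walls Q j,
        ∀ v ∈ cell i, v ≠ vt i l e → v ≠ vt i l' e' → v ∈ cell j ∧ v ≠ x ∧ v ≠ y) ∧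
      ((e' = true ∧ (l ≠ l' → e = false → step (step i l' e') l e ∈ Q → l' < l)) ∨
        (e' = false ∧ e = true ∧ l < l' ∧ step (step i l' e') l e ∈ Q) → key j < key i) := by
  have hp := hpos i hi
  -- Both omitted vertices lie on path `l`, so the face lies in every cell of the line through `i`
  -- in direction `l`. By convexity the line meets `Q` in an interval with `i` at one end, and the
  -- cell sought is the other end.
  by_cases hl : l = l'
  · subst hl
    have hee : e' = !e := by
      cases e <;> cases e' <;> simp_all
    subst hee
    have hline : ∀ {p q r : ℕ}, p ≤ q → q ≤ r → Function.update i l p ∈ Q →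
        Function.update i l r ∈ Q → Function.update i l q ∈ Q := by
      intro p q r hpq hqr h1 h2
      exact hQ.out h1 h2 ⟨update_le_update_iff.2 ⟨hpq, fun _ _ => le_rfl⟩,
        update_le_update_iff.2 ⟨hqr, fun _ _ => le_rfl⟩⟩
    have hi' : Function.update i l (i l) ∈ Q := by simpa using hi
    have hempty : ∀ p, (∀ v ∈ cell i, v ≠ vt i l e → v ≠ vt i l (!e) →
        v ∈ cell (Function.update i l p) ∧ v ≠ vt (Function.update i l p) l e ∧
          v ≠ vt (Function.update i l p) l (!e)) := by
      intro p v hv h1 h2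
      obtain ⟨m, f, rfl⟩ := mem_cell.1 hv
      have hml : m ≠ l := by
        rintro rfl
        cases e <;> cases f <;> simp at h1 h2
      rw [vt_mem_cell, Ne, Ne, vt_eq_vt, vt_eq_vt]
      simp only [hml, false_and, not_false_eq_true, and_true]
      rw [Function.update_of_ne hml]
      cases f <;> simp
    obtain ⟨p, hpQ, hpi, hps, hps', hord⟩ : ∃ p, Function.update i l p ∈ Q ∧ p ≠ i l ∧
        step (Function.update i l p) l (!e) ∉ Q ∧ step (Function.update i l p) l e ∈ Q ∧
        (e = false → p < i l) := by
      cases e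
      · have hex : ∃ p, Function.update i l p ∈ Q := ⟨_, hi'⟩
        classical
        have hlt : Nat.find hex < i l := by
          refine lt_of_le_of_lt (Nat.find_min' hex hy) ?_
          have := hp l
          simp
          omega
        have hpp := hpos _ (Nat.find_spec hex) l
        rw [Function.update_self] at hpp
        refine ⟨Nat.find hex, Nat.find_spec hex, hlt.ne, ?_, ?_, fun _ => hlt⟩
        · intro hmem
          rw [step] at hmem
          simp at hmem
          have := Nat.find_min' hex hmem
          omega
        · rw [step]
          simp only [Function.update_self, Function.update_idem]
          exact hline (Nat.le_succ _) hlt (Nat.find_spec hex) hi'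
      · classical
        set T := (Q.image fun j => j l).filter fun p => Function.update i l p ∈ Q with hT
        have hTm : ∀ p, Function.update i l p ∈ Q → p ∈ T := by
          intro p hp
          rw [hT, Finset.mem_filter]
          exact ⟨Finset.mem_image.2 ⟨_, hp, by simp⟩, hp⟩
        have hne : T.Nonempty := ⟨_, hTm _ hi'⟩
        have hmax := (Finset.mem_filter.1 (T.max'_mem hne)).2
        have hlt : i l < T.max' hne := by
          refine lt_of_lt_of_le ?_ (T.le_max' _ (hTm _ hy))
          simp
        refine ⟨T.max' hne, hmax, hlt.ne', ?_, ?_, by simp⟩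
        · intro hmem
          rw [step] at hmem
          simp at hmem
          have := T.le_max' _ (hTm _ hmem)
          omega
        · rw [step]
          simp only [Function.update_self, Function.update_idem]
          exact hline (by simp; omega) (by simp) hi' hmax
    refine ⟨_, hpQ, ?_, ⟨_, vt_mem_walls.2 hps, _, Finset.mem_sdiff.2 ⟨vt_mem_self _ l e, ?_⟩, ?_⟩,
      ?_⟩
    · intro h
      have := congrFun h l
      simp at this
      exact hpi this
    · rw [vt_mem_walls, not_not]
      exact hps'
    · intro v hv h1 h2
      have := hempty p v hv h1 h2
      exact ⟨this.1, this.2.2, this.2.1⟩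
    · rintro (⟨he, -⟩ | ⟨-, -, hlt, -⟩)
      · have he : e = false := by simpa using he
        refine key_lt_key.2 (Or.inl ?_)
        have hlt := hord he
        refine Finset.sum_lt_sum (fun m _ => ?_) ⟨l, Finset.mem_univ _, by simpa using hlt⟩
        by_cases hm : m = l
        · subst hm; simpa using hlt.le
        · simp [hm]
      · exact absurd hlt (lt_irrefl _)
  · have hl' : l' ≠ l := fun h => hl h.symm
    have e1 : step i l' e' l = i l := by rw [step_apply, if_neg hl]
    have hcov : ∀ j, (∀ m, m ≠ l → m ≠ l' → j m = i m) → (j l = i l ∨ j l = step i l e l) →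
        j l' = step i l' e' l' → ∀ f, (j l = i l → f = e) → (j l = step i l e l → f = !e) →
        ∀ v ∈ cell i, v ≠ vt i l e → v ≠ vt i l' e' →
        v ∈ cell j ∧ v ≠ vt j l f ∧ v ≠ vt j l' (!e') := by
      intro j hj hjl hjl' f hf hf' v hv h1 h2
      obtain ⟨m, g, rfl⟩ := mem_cell.1 hv
      have := hp l
      have := hp l'
      rw [vt_mem_cell, Ne, Ne, vt_eq_vt, vt_eq_vt]
      rw [step_apply, if_pos rfl] at hjl hjl' hf'
      rw [Ne, vt_inj] at h1 h2
      by_cases hm : m = l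
      · subst hm
        rcases hjl with hjl | hjl
        · have := hf hjl
          subst this
          cases f <;> cases g <;> simp [hl] at h1 ⊢ <;> omega
        · have := hf' hjl
          subst this
          cases e <;> cases g <;> simp [hl] at h1 hjl ⊢ <;> omega
      · by_cases hm' : m = l'
        · subst hm'
          cases e' <;> cases g <;> simp [hm] at h2 hjl' ⊢ <;> omega
        · have := hj m hm hm'
          cases g <;> simp [hm, hm', this]
    have hsne : step i l e l ≠ i l := by
      have := hp l
      rw [step_apply, if_pos rfl]
      cases e <;> simp
      omega
    -- Going around the codimension-two face, the four candidates are `i`, its two steps and the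
    -- double step. Since `step i l e` is missing, the other end is the double step if it is in `Q`,
    -- and `step i l' e'` otherwise.
    by_cases hj : step (step i l' e') l e ∈ Q
    · have hjl : step (step i l' e') l e l = step i l e l := by simp [step_apply, hl]
      refine ⟨_, hj, ?_, ⟨vt (step (step i l' e') l e) l' (!e'), ?_,
        vt (step (step i l' e') l e) l (!e), ?_, ?_⟩, ?_⟩
      · intro h
        rw [h] at hjl
        exact hsne hjl.symm
      · rw [vt_mem_walls, ← step_comm hl, step_step (by simpa [step_apply, hl'] using hp l')]
        exact hx
      · rw [Finset.mem_sdiff, vt_mem_walls, not_not, step_step (by simpa [e1] using hp l)]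
        exact ⟨vt_mem_self _ _ _, hy⟩
      · intro v hv h1 h2
        have := hcov _ (fun m hm hm' => by simp [step_apply, hm, hm']) (Or.inr hjl)
          (by simp [step_apply, hl']) (!e) (fun h => absurd (hjl.symm.trans h) hsne)
          (fun _ => rfl) v hv h1 h2
        exact ⟨this.1, this.2.2, this.2.1⟩
      · intro hc
        have hs1 := sum_step_true (hp l)
        have hs2 := sum_step_true (hp l')
        have hs3 := sum_step_true (i := step i l' e') (l := l) (by rw [e1]; exact hp l)
        have hs4 := sum_step_false (step i l' e') l
        have hs5 := sum_step_false i l'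
        rw [key_lt_key]
        rcases hc with ⟨rfl, hc⟩ | ⟨rfl, rfl, hlt, -⟩
        · cases e
          · have hlt := hc hl rfl hj
            refine Or.inr ⟨by omega, l', fun m hm => ?_, ?_⟩
            · simp [step_apply, hm.ne, (hm.trans hlt).ne]
            · have := hp l'
              simp [step_apply, hl']
              omega
          · left; omega
        · refine Or.inr ⟨by omega, l, fun m hm => ?_, ?_⟩
          · simp [step_apply, hm.ne, (hm.trans hlt).ne]
          · have := hp l
            simp [step_apply, hl]
            omega
    · refine ⟨_, hy, step_ne (hp l'), ⟨vt (step i l' e') l e, vt_mem_walls.2 hj,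
        vt (step i l' e') l' (!e'), ?_, ?_⟩, ?_⟩
      · rw [Finset.mem_sdiff, vt_mem_walls, not_not, step_step (hp l')]
        exact ⟨vt_mem_self _ _ _, hi⟩
      · exact hcov _ (fun m hm hm' => by simp [step_apply, hm']) (Or.inl e1) rfl e
          (fun _ => rfl) (fun h => absurd (h.symm.trans e1) hsne)
      · rintro (⟨rfl, -⟩ | ⟨-, -, -, h⟩)
        · have := sum_step_true (hp l')
          exact key_lt_key.2 (Or.inl (by omega))
        · exact absurd h hj

end Cells


/-! ### The ball contributed by one cell. -/

section Attaching

variable {d : ℕ}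

/-- The facets of a triangulation of the ball with boundary `∂A * ∂(B ∪ {w})`, where `A` is the set
of walls of the cell `i` and `B` its complement: `A * ∂(B ∪ {w})` if `b` holds and
`∂A * (B ∪ {w})` otherwise. -/
def cellFacets (Q : Finset (Fin d → ℕ)) (w : Vertex d) (b : Prop) (i : Fin d → ℕ) :
    Set (Finset (Vertex d)) :=
  {F | ∃ z, ((b ∧ z ∈ insert w (cell i \ walls Q i)) ∨ (¬b ∧ z ∈ walls Q i)) ∧
    F = (insert w (cell i)).erase z}

variable {Q : Finset (Fin d → ℕ)} {w : Vertex d} {b : Prop} {i : Fin d → ℕ}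

theorem subset_of_mem_cellFacets {F : Finset (Vertex d)} (h : F ∈ cellFacets Q w b i) :
    F ⊆ insert w (cell i) := by
  obtain ⟨z, -, rfl⟩ := h
  exact Finset.erase_subset _ _

theorem card_of_mem_cellFacets (hw : w ∉ cell i) {F : Finset (Vertex d)}
    (h : F ∈ cellFacets Q w b i) : F.card = 2 * d := by
  obtain ⟨z, hz, rfl⟩ := h
  have hz' : z ∈ insert w (cell i) := by
    rcases hz with ⟨-, hz⟩ | ⟨-, hz⟩
    · exact Finset.insert_subset_insert _ Finset.sdiff_subset hz
    · exact Finset.mem_insert_of_mem (walls_subset_cell _ _ hz)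
  rw [Finset.card_erase_of_mem hz', Finset.card_insert_of_notMem hw, card_cell]
  rfl

/-- Both triangulations have the same boundary, so covering a face that misses a wall and a non-wall
does not depend on `b`. -/
theorem exists_cellFacet_of_subset {H : Finset (Vertex d)} {x y : Vertex d}
    (hH : H ⊆ insert w (cell i)) (hx : x ∈ walls Q i) (hxH : x ∉ H)
    (hy : y ∈ insert w (cell i \ walls Q i)) (hyH : y ∉ H) (b : Prop) :
    ∃ F ∈ cellFacets Q w b i, H ⊆ F := by
  by_cases hb : b
  · exact ⟨_, ⟨y, Or.inl ⟨hb, hy⟩, rfl⟩, Finset.subset_erase.2 ⟨hH, hyH⟩⟩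
  · exact ⟨_, ⟨x, Or.inr ⟨hb, hx⟩, rfl⟩, Finset.subset_erase.2 ⟨hH, hxH⟩⟩

/-- The hypotheses treat walls and non-walls symmetrically; for `b` the relation is transposed
before `Shelled.attach` is applied. -/
theorem Shelled.attach_cell {S : Set (Finset (Vertex d))} (hS : Shelled (2 * d) S)
    (hw : w ∉ cell i) (P : Vertex d → Vertex d → Prop)
    (hP : ∀ x y, P x y → x ∈ walls Q i ∧ y ∈ insert w (cell i \ walls Q i) ∧
      ∃ F' ∈ S, ((insert w (cell i)).erase x).erase y ⊆ F')
    (hmeet : ∀ F' ∈ S, ∀ z, (b ∧ z ∈ insert w (cell i \ walls Q i)) ∨ (¬b ∧ z ∈ walls Q i) →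
      ∃ x y, P x y ∧ (x ∉ F' ∨ x = z) ∧ (y ∉ F' ∨ y = z))
    (hferrers : ∀ x x' y y', P x y → P x' y' → P x y' ∨ P x' y) :
    Shelled (2 * d) (S ∪ cellFacets Q w b i) := by
  have hW : (insert w (cell i)).card = 2 * d + 1 := by
    rw [Finset.card_insert_of_notMem hw, card_cell]
  have hA : walls Q i ⊆ insert w (cell i) :=
    (walls_subset_cell Q i).trans (Finset.subset_insert _ _)
  have hB : insert w (cell i \ walls Q i) ⊆ insert w (cell i) :=
    Finset.insert_subset_insert _ Finset.sdiff_subset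
  have hAB : ∀ x ∈ walls Q i, x ∉ insert w (cell i \ walls Q i) := by
    intro x hx hx'
    rcases Finset.mem_insert.1 hx' with rfl | hx'
    · exact hw (walls_subset_cell Q i hx)
    · exact (Finset.mem_sdiff.1 hx').2 hx
  by_cases hb : b
  · have : cellFacets Q w b i = (insert w (cell i)).erase ''
        ((insert w (cell i \ walls Q i) : Finset (Vertex d)) : Set (Vertex d)) := by
      ext F
      constructor
      · rintro ⟨z, hz, rfl⟩
        exact ⟨z, by simpa [hb] using hz, rfl⟩
      · rintro ⟨z, hz, rfl⟩
        exact ⟨z, Or.inl ⟨hb, hz⟩, rfl⟩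
    rw [this]
    refine hS.attach hW (fun y x => P x y) _ hB ?_ ?_ ?_
    · intro y hy x hxy
      obtain ⟨hx, -, F', hF', hsub⟩ := hP x y hxy
      refine ⟨hA hx, fun e => hAB x hx (e ▸ hy), F', hF', ?_⟩
      rwa [Finset.erase_right_comm]
    · intro F' hF' z hz
      obtain ⟨x, y, hxy, h1, h2⟩ := hmeet F' hF' z (Or.inl ⟨hb, hz⟩)
      obtain ⟨hx, hy, -⟩ := hP x y hxy
      exact ⟨y, hy, x, hxy, h2, h1.resolve_right fun e => hAB x hx (e ▸ hz)⟩
    · intro y _ y' _ x x' h h'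
      exact (hferrers x x' y y' h h').symm
  · have : cellFacets Q w b i = (insert w (cell i)).erase '' (walls Q i : Set (Vertex d)) := by
      ext F
      constructor
      · rintro ⟨z, hz, rfl⟩
        exact ⟨z, by simpa [hb] using hz, rfl⟩
      · rintro ⟨z, hz, rfl⟩
        exact ⟨z, Or.inr ⟨hb, hz⟩, rfl⟩
    rw [this]
    refine hS.attach hW P _ hA ?_ ?_ ?_
    · intro x hx y hxy
      obtain ⟨-, hy, hF'⟩ := hP x y hxy
      exact ⟨hB hy, fun e => hAB x hx (e ▸ hy), hF'⟩
    · intro F' hF' z hz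
      obtain ⟨x, y, hxy, h1, h2⟩ := hmeet F' hF' z (Or.inr ⟨hb, hz⟩)
      obtain ⟨hx, hy, -⟩ := hP x y hxy
      exact ⟨x, hx, y, hxy, h1, h2.resolve_right fun e => hAB z hz (e ▸ hy)⟩
    · intro x _ x' _
      exact hferrers x x'

end Attaching

/-! ### Slabs, their facets, and the shelling of the ball. -/

section Slabs

variable {d n : ℕ}

/-- The index tuples of all facets of the join of the paths. -/
def box (d n : ℕ) : Finset (Fin d → ℕ) := Fintype.piFinset fun _ : Fin d => Finset.Icc 1 (n - 1)

/-- The number of the slab that contains the cell `i`. -/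
def level (i : Fin d → ℕ) : ℕ := (∑ l, i l) / (d + 2) + 1

theorem mem_box {i : Fin d → ℕ} : i ∈ box d n ↔ ∀ l, 1 ≤ i l ∧ i l ≤ n - 1 := by
  simp [box]

theorem level_eq_level_iff {i j : Fin d → ℕ} : level j = level i ↔
    (d + 2) * ((∑ l, i l) / (d + 2)) ≤ ∑ l, j l ∧
      ∑ l, j l < (d + 2) * ((∑ l, i l) / (d + 2)) + (d + 2) := by
  have h1 := Nat.div_add_mod (∑ l, j l) (d + 2)
  have h2 := Nat.mod_lt (∑ l, j l) (show 0 < d + 2 by omega)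
  rw [level, level, Nat.add_right_cancel_iff]
  constructor
  · intro h
    rw [h] at h1
    omega
  · rintro ⟨h3, h4⟩
    exact Nat.div_eq_of_lt_le (by rw [mul_comm]; exact h3) (by rw [mul_comm]; linarith)

theorem mem_slabIndices {k : ℕ} (hk : 1 ≤ k) {j : Fin d → ℕ} :
    j ∈ slabIndices d n k ↔ j ∈ box d n ∧ level j = k := by
  obtain ⟨q, rfl⟩ : ∃ q, k = q + 1 := ⟨k - 1, by omega⟩
  rw [slabIndices, Finset.mem_filter, ← box]
  refine and_congr_right fun _ => ?_
  have h1 := Nat.div_add_mod (∑ l, j l) (d + 2)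
  have h2 := Nat.mod_lt (∑ l, j l) (show 0 < d + 2 by omega)
  have h3 : (q + 1) * (d + 2) = (d + 2) * q + (d + 2) := by ring
  rw [level, Nat.add_right_cancel_iff, h3, Nat.add_sub_cancel, mul_comm q]
  constructor
  · rintro ⟨h4, h5⟩
    exact Nat.div_eq_of_lt_le (by rw [mul_comm]; exact h4) (by rw [h3]; omega)
  · rintro rfl
    omega

theorem mem_slab_level {i j : Fin d → ℕ} :
    j ∈ slabIndices d n (level i) ↔ j ∈ box d n ∧ level j = level i :=
  mem_slabIndices (Nat.succ_pos _)

theorem self_mem_slab {i : Fin d → ℕ} (hi : i ∈ box d n) : i ∈ slabIndices d n (level i) :=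
  mem_slab_level.2 ⟨hi, rfl⟩

theorem level_mono {i j : Fin d → ℕ} (h : i ≤ j) : level i ≤ level j :=
  Nat.succ_le_succ (Nat.div_le_div_right (Finset.sum_le_sum fun l _ => h l))

theorem ordConnected_box : (box d n : Set (Fin d → ℕ)).OrdConnected := by
  refine ⟨fun x hx y hy z hz => ?_⟩
  rw [Finset.mem_coe, mem_box] at *
  exact fun l => ⟨(hx l).1.trans (hz.1 l), (hz.2 l).trans (hy l).2⟩

/-- The box is convex and `level` is monotone. -/
theorem ordConnected_slab {i : Fin d → ℕ} :
    (slabIndices d n (level i) : Set (Fin d → ℕ)).OrdConnected := by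
  refine ⟨fun x hx y hy z hz => ?_⟩
  rw [Finset.mem_coe, mem_slab_level] at *
  exact ⟨ordConnected_box.out hx.1 hy.1 hz,
    le_antisymm (hy.2 ▸ level_mono hz.2) (hx.2 ▸ level_mono hz.1)⟩

theorem pos_of_mem_slab {i : Fin d → ℕ} : ∀ j ∈ slabIndices d n (level i), ∀ l, 1 ≤ j l :=
  fun _ hj l => (mem_box.1 (mem_slab_level.1 hj).1 l).1

theorem step_true_mem_box {i : Fin d → ℕ} (hi : i ∈ box d n) {l : Fin d} :
    step i l true ∈ box d n ↔ 2 ≤ i l := by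
  rw [mem_box] at *
  constructor
  · intro h
    have := (h l).1
    simp [step_apply] at this
    omega
  · intro h m
    rw [step_apply]
    have := hi m
    by_cases hm : m = l
    · subst hm; simp; omega
    · simpa [hm] using this

theorem step_false_mem_box {i : Fin d → ℕ} (hi : i ∈ box d n) {l : Fin d} :
    step i l false ∈ box d n ↔ i l + 1 ≤ n - 1 := by
  rw [mem_box] at *
  constructor
  · intro h
    simpa [step_apply] using (h l).2
  · intro h m
    rw [step_apply]
    have := hi m
    by_cases hm : m = l
    · subst hm; simp; omega
    · simpa [hm] using this

theorem level_eq_iff_of_sum_add_one {i j : Fin d → ℕ} (h : ∑ l, j l + 1 = ∑ l, i l) :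
    level j = level i ↔ (∑ l, i l) % (d + 2) ≠ 0 := by
  have h1 := Nat.div_add_mod (∑ l, i l) (d + 2)
  have h2 := Nat.mod_lt (∑ l, i l) (show 0 < d + 2 by omega)
  rw [level_eq_level_iff]
  omega

theorem level_eq_iff_of_sum_eq_add_one {i j : Fin d → ℕ} (h : ∑ l, j l = ∑ l, i l + 1) :
    level j = level i ↔ (∑ l, i l) % (d + 2) ≠ d + 1 := by
  have h1 := Nat.div_add_mod (∑ l, i l) (d + 2)
  have h2 := Nat.mod_lt (∑ l, i l) (show 0 < d + 2 by omega)
  rw [level_eq_level_iff]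
  omega

theorem step_true_mem_slab {i : Fin d → ℕ} (hi : i ∈ box d n) {l : Fin d} :
    step i l true ∈ slabIndices d n (level i) ↔ 2 ≤ i l ∧ (∑ l, i l) % (d + 2) ≠ 0 := by
  rw [mem_slab_level, step_true_mem_box hi,
    level_eq_iff_of_sum_add_one (sum_step_true (mem_box.1 hi l).1)]

theorem step_false_mem_slab {i : Fin d → ℕ} (hi : i ∈ box d n) {l : Fin d} :
    step i l false ∈ slabIndices d n (level i) ↔
      i l + 1 ≤ n - 1 ∧ (∑ l, i l) % (d + 2) ≠ d + 1 := by
  rw [mem_slab_level, step_false_mem_box hi, level_eq_iff_of_sum_eq_add_one (sum_step_false i l)]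

/-- The facets `F * ∂(G * o)` are used for the cell `i`. This includes the case of a slab that is
a single simplex. -/
def Flipped (n : ℕ) (c : (Fin d → ℕ) → Bool) (i : Fin d → ℕ) : Prop :=
  (slabIndices d n (level i)).card = 1 ∨
    (((∑ l, i l) % (d + 2) = 0 ∨ (∑ l, i l) % (d + 2) = d + 1) ∧ c i = true)

/-- The facets of the ball that replaces a slab which come from the cell `i`. -/
def facets (n : ℕ) (c : (Fin d → ℕ) → Bool) (i : Fin d → ℕ) : Set (Finset (Vertex d)) :=
  cellFacets (slabIndices d n (level i)) (Vertex.o (level i)) (Flipped n c i) i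

theorem vt_notMem_facet {c : (Fin d → ℕ) → Bool} {i j : Fin d → ℕ} {F : Finset (Vertex d)}
    (hF : F ∈ facets n c j) {l : Fin d} {e : Bool}
    (h : i l + e.toNat ≠ j l ∧ i l + e.toNat ≠ j l + 1) : vt i l e ∉ F := by
  intro hv
  rcases Finset.mem_insert.1 (subset_of_mem_cellFacets hF hv) with h' | h'
  · simp [vt] at h'
  · rcases vt_mem_cell.1 h' with h' | h'
    exacts [h.1 h', h.2 h']

theorem o_notMem_facet {c : (Fin d → ℕ) → Bool} {i j : Fin d → ℕ} {F : Finset (Vertex d)}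
    (hF : F ∈ facets n c j) (h : level j ≠ level i) : Vertex.o (level i) ∉ F := by
  intro hv
  rcases Finset.mem_insert.1 (subset_of_mem_cellFacets hF hv) with h' | h'
  · exact h (by simpa using h'.symm)
  · exact o_notMem_cell h'

theorem erase_erase_subset_of_forall {w w' x y : Vertex d} {i j : Fin d → ℕ}
    {x' y' : Vertex d} (hw : w = w') (hx' : x' ∈ cell j) (hy' : y' ∈ cell j) (hwj : w' ∉ cell j)
    (h : ∀ v ∈ cell i, v ≠ x → v ≠ y → v ∈ cell j ∧ v ≠ x' ∧ v ≠ y') :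
    ((insert w (cell i)).erase x).erase y ⊆ insert w' (cell j) ∧
      x' ∉ ((insert w (cell i)).erase x).erase y ∧ y' ∉ ((insert w (cell i)).erase x).erase y := by
  subst hw
  have key : ∀ v ∈ ((insert w (cell i)).erase x).erase y,
      v = w ∨ (v ∈ cell j ∧ v ≠ x' ∧ v ≠ y') := by
    intro v hv
    obtain ⟨hvy, hv⟩ := Finset.mem_erase.1 hv
    obtain ⟨hvx, hv⟩ := Finset.mem_erase.1 hv
    exact (Finset.mem_insert.1 hv).imp_right fun hv => h v hv hvx hvy
  refine ⟨fun v hv => ?_, fun hv => ?_, fun hv => ?_⟩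
  · exact Finset.mem_insert.2 ((key v hv).imp_right And.left)
  · rcases key _ hv with rfl | h
    exacts [hwj hx', h.2.1 rfl]
  · rcases key _ hv with rfl | h
    exacts [hwj hy', h.2.2 rfl]

/-- A face opposite to a wall and a non-wall of a cell is contained in a facet coming from
another cell of the same slab. -/
theorem exists_facet_of_neighbor (c : (Fin d → ℕ) → Bool) {i : Fin d → ℕ} (hi : i ∈ box d n)
    {l l' : Fin d} {e e' : Bool} (hx : step i l e ∉ slabIndices d n (level i))
    (hy : step i l' e' ∈ slabIndices d n (level i)) :
    ∃ j ∈ box d n, j ≠ i ∧ (∃ F ∈ facets n c j,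
        ((insert (Vertex.o (level i)) (cell i)).erase (vt i l e)).erase (vt i l' e') ⊆ F) ∧
      ((e' = true ∧ (l ≠ l' → e = false →
          step (step i l' e') l e ∈ slabIndices d n (level i) → l' < l)) ∨
        (e' = false ∧ e = true ∧ l < l' ∧
          step (step i l' e') l e ∈ slabIndices d n (level i)) → key j < key i) := by
  obtain ⟨j, hj, hne, ⟨x, hx, y, hy, hsub⟩, hord⟩ :=
    exists_neighbor ordConnected_slab pos_of_mem_slab (self_mem_slab hi) hx hy
  obtain ⟨hjb, hlev⟩ := mem_slab_level.1 hj
  obtain ⟨h1, h2, h3⟩ := erase_erase_subset_of_forall (w := Vertex.o (level i))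
    (w' := Vertex.o (level j)) (by rw [hlev]) (walls_subset_cell _ _ hx) (Finset.mem_sdiff.1 hy).1
    o_notMem_cell hsub
  refine ⟨j, hjb, hne, ?_, hord⟩
  rw [← hlev] at hx hy
  exact exists_cellFacet_of_subset h1 hx h2 (Finset.mem_insert_of_mem hy) h3 (Flipped n c j)

/-- A wall of a cell which is not on the boundary of the box lies in a facet from the
neighboring cell. -/
theorem exists_facet_of_wall (c : (Fin d → ℕ) → Bool) {i : Fin d → ℕ} (hi : i ∈ box d n)
    {l : Fin d} {e : Bool} (hx : step i l e ∉ slabIndices d n (level i))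
    (hb : step i l e ∈ box d n) :
    ∃ F ∈ facets n c (step i l e), (cell i).erase (vt i l e) ⊆ F := by
  have hlev : level (step i l e) ≠ level i := fun h => hx (mem_slab_level.2 ⟨hb, h⟩)
  have hpos := (mem_box.1 hi l).1
  have hsub := cell_erase_subset_step (e := e) hpos
  refine exists_cellFacet_of_subset (x := vt (step i l e) l (!e))
    (y := Vertex.o (level (step i l e))) ?_ ?_ ?_ (Finset.mem_insert_self _ _) ?_ _
  · exact (hsub.trans (Finset.erase_subset _ _)).trans (Finset.subset_insert _ _)
  · rw [vt_mem_walls, step_step hpos, mem_slab_level]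
    exact fun h => hlev h.2.symm
  · exact fun h => (Finset.mem_erase.1 (hsub h)).1 rfl
  · exact fun h => o_notMem_cell (Finset.mem_of_mem_erase h)

/-- All downward steps leave the slab. Earlier facets are met through the slab below (ridges
omitting `o`) and through lexicographically smaller cells of the same diagonal (one index up, an
earlier one down). The neighbourhood of the wall on path `l'` is `o` together with paths after `l'`,
hence decreases with `l'`. -/
theorem Shelled.attach_low {c : (Fin d → ℕ) → Bool} {i : Fin d → ℕ} (hi : i ∈ box d n)
    (h0 : (∑ l, i l) % (d + 2) = 0) {S : Set (Finset (Vertex d))}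
    (hS : Shelled (2 * d) S)
    (hmem : ∀ F, F ∈ S ↔ ∃ j ∈ box d n, key j < key i ∧ F ∈ facets n c j) :
    Shelled (2 * d) (S ∪ facets n c i) := by
  have hup : ∀ l, i l + 1 ≤ n - 1 → step i l false ∈ slabIndices d n (level i) := fun l hl =>
    (step_false_mem_slab hi).2 ⟨hl, by omega⟩
  have hdown : ∀ l, step i l true ∉ slabIndices d n (level i) := fun l h =>
    ((step_true_mem_slab hi).1 h).2 h0
  refine hS.attach_cell o_notMem_cell (fun x y => ∃ l', 2 ≤ i l' ∧ x = vt i l' true ∧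
    (y = Vertex.o (level i) ∨ ∃ l, l' < l ∧ i l + 1 ≤ n - 1 ∧ y = vt i l false)) ?_ ?_ ?_
  · rintro x y ⟨l', hl', rfl, hy⟩
    refine ⟨vt_mem_walls.2 (hdown l'), ?_, ?_⟩
    · rcases hy with rfl | ⟨l, -, hl, rfl⟩
      · exact Finset.mem_insert_self _ _
      · refine Finset.mem_insert_of_mem (Finset.mem_sdiff.2 ⟨vt_mem_self _ _ _, ?_⟩)
        rw [vt_mem_walls, not_not]
        exact hup l hl
    · rcases hy with rfl | ⟨l, hll, hl, rfl⟩
      · have hb := (step_true_mem_box hi).2 hl'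
        obtain ⟨F, hF, hsub⟩ := exists_facet_of_wall c hi (hdown l') hb
        refine ⟨F, (hmem F).2 ⟨_, hb, key_lt_key.2 (Or.inl ?_), hF⟩, ?_⟩
        · have := sum_step_true (mem_box.1 hi l').1
          omega
        · rw [Finset.erase_right_comm, Finset.erase_insert o_notMem_cell]
          exact hsub
      · obtain ⟨j, hj, -, ⟨F, hF, hsub⟩, hord⟩ :=
          exists_facet_of_neighbor c hi (hdown l') (hup l hl)
        refine ⟨F, (hmem F).2 ⟨j, hj, hord (Or.inr ⟨rfl, rfl, hll, ?_⟩), hF⟩, hsub⟩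
        have hb : step i l false ∈ box d n := (step_false_mem_box hi).2 hl
        have h1 : step i l false l' = i l' := by rw [step_apply, if_neg hll.ne]
        have h2 := sum_step_true (i := step i l false) (l := l') (by omega)
        have h3 := sum_step_false i l
        refine mem_slab_level.2 ⟨(step_true_mem_box hb).2 (by omega), ?_⟩
        rw [level, level, show ∑ m, step (step i l false) l' true m = ∑ m, i m by omega]
  · rintro F' hF' z -
    obtain ⟨j, hj, hji, hF'⟩ := (hmem F').1 hF'
    by_cases hlev : level j = level i
    · have hs : ∑ l, j l = ∑ l, i l := by
        have h1 := Nat.div_add_mod (∑ l, i l) (d + 2)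
        have h2 := level_eq_level_iff.1 hlev
        rcases key_lt_key.1 hji with h | h <;> omega
      obtain ⟨l', l, hll, h1, h2⟩ := exists_lt_gt_of_key_lt hji hs
      have := mem_box.1 hj l'
      have := mem_box.1 hj l
      refine ⟨_, _, ⟨l', by omega, rfl, Or.inr ⟨l, hll, by omega, rfl⟩⟩,
        Or.inl (vt_notMem_facet hF' ?_), Or.inl (vt_notMem_facet hF' ?_)⟩
      · simp; omega
      · simp; omega
    · obtain ⟨l', hl'⟩ := exists_lt_of_key_lt hji
      have := mem_box.1 hj l'
      refine ⟨_, _, ⟨l', by omega, rfl, Or.inl rfl⟩, Or.inl (vt_notMem_facet hF' ?_),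
        Or.inl (o_notMem_facet hF' hlev)⟩
      simp; omega
  · rintro x x' y y' ⟨l1, h1, rfl, hy⟩ ⟨l2, h2, rfl, hy'⟩
    rcases hy with rfl | ⟨m1, hm1, hm1', rfl⟩
    · exact Or.inr ⟨l2, h2, rfl, Or.inl rfl⟩
    rcases hy' with rfl | ⟨m2, hm2, hm2', rfl⟩
    · exact Or.inl ⟨l1, h1, rfl, Or.inl rfl⟩
    rcases le_or_gt m2 l1 with h | h
    · exact Or.inr ⟨l2, h2, rfl, Or.inr ⟨m1, (hm2.trans_le h).trans hm1, hm1', rfl⟩⟩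
    · exact Or.inl ⟨l1, h1, rfl, Or.inr ⟨m2, h, hm2', rfl⟩⟩

/-- Downward steps inside the box stay in the slab, so earlier facets are met in ridges omitting a
lower non-wall on a path `l'` and a wall. A wall at the boundary of the box pairs with every such
`l'`. An upward wall on path `l` caused only by the upper diagonal pairs with `l' ≤ l`: for `l' > l`
the cell across the ridge may be a later one of the same diagonal. -/
theorem Shelled.attach_not_low {c : (Fin d → ℕ) → Bool} {i : Fin d → ℕ} (hi : i ∈ box d n)
    (h0 : (∑ l, i l) % (d + 2) ≠ 0) {S : Set (Finset (Vertex d))}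
    (hS : Shelled (2 * d) S)
    (hmem : ∀ F, F ∈ S ↔ ∃ j ∈ box d n, key j < key i ∧ F ∈ facets n c j) :
    Shelled (2 * d) (S ∪ facets n c i) := by
  have hib := mem_box.1 hi
  have hdown : ∀ l, 2 ≤ i l → step i l true ∈ slabIndices d n (level i) := fun l hl =>
    (step_true_mem_slab hi).2 ⟨hl, h0⟩
  refine hS.attach_cell o_notMem_cell (fun x y => ∃ l' l e, 2 ≤ i l' ∧ y = vt i l' true ∧
    x = vt i l e ∧ step i l e ∉ slabIndices d n (level i) ∧
    (e = false → i l = n - 1 ∨ l' ≤ l)) ?_ ?_ ?_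
  · rintro x y ⟨l', l, e, hl', rfl, rfl, he, hle⟩
    refine ⟨vt_mem_walls.2 he, Finset.mem_insert_of_mem
      (Finset.mem_sdiff.2 ⟨vt_mem_self _ _ _, ?_⟩), ?_⟩
    · rw [vt_mem_walls, not_not]
      exact hdown l' hl'
    · obtain ⟨j, hj, -, ⟨F, hF, hsub⟩, hord⟩ := exists_facet_of_neighbor c hi he (hdown l' hl')
      refine ⟨F, (hmem F).2 ⟨j, hj, hord (Or.inl ⟨rfl, ?_⟩), hF⟩, hsub⟩
      rintro hne rfl hst
      rcases hle rfl with h | h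
      · have := (step_false_mem_box ((step_true_mem_box hi).2 hl')).1 (mem_slab_level.1 hst).1
        rw [step_apply, if_neg hne] at this
        omega
      · exact lt_of_le_of_ne h (Ne.symm hne)
  · intro F' hF' z hz
    obtain ⟨j, hj, hji, hF'⟩ := (hmem F').1 hF'
    have hjb := mem_box.1 hj
    obtain ⟨l', hl'⟩ := exists_lt_of_key_lt hji
    have hl'2 : 2 ≤ i l' := by have := hjb l'; omega
    have hyF' : vt i l' true ∉ F' := vt_notMem_facet hF' (by simp; omega)
    by_cases htop : (∑ l, i l) % (d + 2) = d + 1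
    · have hwall : ∀ l, step i l false ∉ slabIndices d n (level i) := fun l h =>
        ((step_false_mem_slab hi).1 h).2 htop
      -- In this case `F'` misses both vertices of the cell `i` on path `m`, one a wall and the
      -- other not.
      by_cases hA : ∃ m, j m + 2 ≤ i m
      · obtain ⟨m, hm⟩ := hA
        refine ⟨_, _, ⟨m, m, false, by omega, rfl, rfl, hwall m, fun _ => Or.inr le_rfl⟩,
          Or.inl (vt_notMem_facet hF' ?_), Or.inl (vt_notMem_facet hF' ?_)⟩ <;> simp <;> omega
      push Not at hA
      -- With residue d + 1 for `i`, this leaves residue at least 1 for `j`, so `j` is in the same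
      -- slab and off its lower diagonal.
      have hsum : ∑ l, i l ≤ ∑ l, j l + d := by
        have : ∑ l, i l ≤ ∑ l, (j l + 1) := Finset.sum_le_sum fun m _ => by
          have := hA m
          omega
        simpa [Finset.sum_add_distrib] using this
      have hsum' : ∑ l, j l ≤ ∑ l, i l := by
        rcases key_lt_key.1 hji with h | h <;> omega
      have hdm := Nat.div_add_mod (∑ l, i l) (d + 2)
      have hlev : level j = level i := level_eq_level_iff.2 (by omega)
      rcases hsum'.eq_or_lt with hs | hs
      · obtain ⟨m', m, hmm, h1, h2⟩ := exists_lt_gt_of_key_lt hji hs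
        have := hjb m'
        refine ⟨_, _, ⟨m', m, false, by omega, rfl, rfl, hwall m, fun _ => Or.inr hmm.le⟩,
          Or.inl (vt_notMem_facet hF' ?_), Or.inl (vt_notMem_facet hF' ?_)⟩ <;> simp <;> omega
      · have hdmj := Nat.div_add_mod (∑ l, j l) (d + 2)
        have hq : (∑ l, j l) / (d + 2) = (∑ l, i l) / (d + 2) := Nat.succ_injective hlev
        rw [hq] at hdmj
        obtain ⟨x', hx', rfl⟩ := hF'
        -- Here `j` lies strictly between the diagonals, so its facets omit a wall, and that wall is
        -- on the boundary of the box.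
        have hx' : x' ∈ walls (slabIndices d n (level j)) j := by
          rcases hx' with ⟨hf, -⟩ | ⟨-, hx'⟩
          · rcases hf with hf | ⟨hf, -⟩
            · obtain ⟨a, ha⟩ := Finset.card_eq_one.1 hf
              have h1 := self_mem_slab hj
              have h2 := self_mem_slab hi
              rw [← hlev, ha, Finset.mem_singleton] at h2
              rw [ha, Finset.mem_singleton] at h1
              rw [h1, h2] at hs
              exact absurd hs (lt_irrefl _)
            · omega
          · exact hx'
        obtain ⟨m, e, he, rfl⟩ := mem_walls.1 hx'
        -- On path `m` only one vertex of `F'` is left, the end vertex `n` or 1 of that path; so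
        -- `F'` misses a suitable vertex of the cell `i` there.
        have hnot : ∀ p, Vertex.a m p ∈ (insert (Vertex.o (level j)) (cell j)).erase (vt j m e) →
            p = j m + (!e).toNat := by
          intro p hp
          obtain ⟨h1, h2⟩ := Finset.mem_erase.1 hp
          have h2 := a_mem_cell.1 ((Finset.mem_insert.1 h2).resolve_left (by simp))
          simp only [vt, Ne, Vertex.a.injEq, true_and] at h1
          cases e <;> simp at h1 ⊢ <;> omega
        have hbi := hib m
        have hbj := hjb m
        cases e
        · rw [step_false_mem_slab hj] at he
          have hjm : j m = n - 1 := by omega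
          by_cases him : i m = n - 1
          · refine ⟨_, _, ⟨l', m, false, hl'2, rfl, rfl, hwall m, fun _ => Or.inl him⟩,
              Or.inl fun h => ?_, Or.inl hyF'⟩
            have := hnot _ h
            simp at this; omega
          · by_cases him' : 2 ≤ i m
            · refine ⟨_, _, ⟨m, m, false, him', rfl, rfl, hwall m, fun _ => Or.inr le_rfl⟩,
                Or.inl fun h => ?_, Or.inl fun h => ?_⟩ <;>
              · have := hnot _ h
                simp at this; omega
            · refine ⟨_, _, ⟨l', m, true, hl'2, rfl, rfl, ?_, by simp⟩,
                Or.inl fun h => ?_, Or.inl hyF'⟩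
              · exact fun h => him' ((step_true_mem_slab hi).1 h).1
              · have := hnot _ h
                simp at this; omega
        · rw [step_true_mem_slab hj] at he
          have hjm : j m = 1 := by omega
          by_cases him' : 2 ≤ i m
          · refine ⟨_, _, ⟨m, m, false, him', rfl, rfl, hwall m, fun _ => Or.inr le_rfl⟩,
                Or.inl fun h => ?_, Or.inl fun h => ?_⟩ <;>
              · have := hnot _ h
                simp at this; omega
          · refine ⟨_, _, ⟨l', m, true, hl'2, rfl, rfl, ?_, by simp⟩,
              Or.inl fun h => ?_, Or.inl hyF'⟩
            · exact fun h => him' ((step_true_mem_slab hi).1 h).1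
            · have := hnot _ h
              simp at this; omega
    · have hz : z ∈ walls (slabIndices d n (level i)) i := by
        rcases hz with ⟨hf, -⟩ | ⟨-, hz⟩
        · rcases hf with hf | ⟨hf, -⟩
          · obtain ⟨a, ha⟩ := Finset.card_eq_one.1 hf
            have h1 := self_mem_slab hi
            have h2 := hdown l' hl'2
            rw [ha, Finset.mem_singleton] at h1 h2
            exact absurd (h2.trans h1.symm) (step_ne (hib l').1)
          · omega
        · exact hz
      obtain ⟨l, e, he, rfl⟩ := mem_walls.1 hz
      refine ⟨_, _, ⟨l', l, e, hl'2, rfl, rfl, he, ?_⟩, Or.inr rfl, Or.inl hyF'⟩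
      rintro rfl
      rw [step_false_mem_slab hi] at he
      have := hib l
      left; omega
  -- The neighbourhood of a wall is either all admissible `l'` or those with `l' ≤ l`; these form a
  -- chain.
  · rintro x x' y y' ⟨l1, m1, e1, h1, rfl, rfl, he1, hc1⟩ ⟨l2, m2, e2, h2, rfl, rfl, he2, hc2⟩
    by_cases hc : e1 = false → i m1 = n - 1 ∨ l2 ≤ m1
    · exact Or.inl ⟨l2, m1, e1, h2, rfl, rfl, he1, hc⟩
    · push Not at hc
      obtain ⟨h3, h4, h5⟩ := hc
      have h6 := (hc1 h3).resolve_left h4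
      exact Or.inr ⟨l1, m2, e2, h1, rfl, rfl, he2, fun h =>
        (hc2 h).imp_right fun h7 => (h6.trans h5.le).trans h7⟩

theorem shelled_facets (n : ℕ) (c : (Fin d → ℕ) → Bool) :
    Shelled (2 * d) {F | ∃ i ∈ box d n, F ∈ facets n c i} := by
  have := Shelled.empty.extend (N := 2 * d) key_injective (facets n c) (box d n) (by
    intro i hi hS
    have hmem : ∀ F, F ∈ (∅ : Set (Finset (Vertex d))) ∪
        {F | ∃ j ∈ box d n, key j < key i ∧ F ∈ facets n c j} ↔
        ∃ j ∈ box d n, key j < key i ∧ F ∈ facets n c j := by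
      simp
    by_cases h0 : (∑ l, i l) % (d + 2) = 0
    · exact hS.attach_low hi h0 hmem
    · exact hS.attach_not_low hi h0 hmem)
  simpa using this

/-! ### Extending the shelling over the cone on the boundary. -/

/-- The facets of the cone with apex `apex` over the boundary of the join of the paths which come
from the cell `i`. -/
def apexFacets (n : ℕ) (i : Fin d → ℕ) : Set (Finset (Vertex d)) :=
  cellFacets (box d n) Vertex.apex False i

theorem wall_slab_of_wall_box {i : Fin d → ℕ} {l : Fin d} {e : Bool} (h : step i l e ∉ box d n) :
    step i l e ∉ slabIndices d n (level i) := fun h' => h (mem_slab_level.1 h').1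

/-- Every ridge omitting `apex` already lies in the ball, and every ridge omitting a wall and a
lower non-wall lies in an earlier cone facet. The relation is a product, hence trivially Ferrers. -/
theorem Shelled.attach_apex {c : (Fin d → ℕ) → Bool} {i : Fin d → ℕ} (hi : i ∈ box d n)
    {S : Set (Finset (Vertex d))} (hS : Shelled (2 * d) S)
    (hmem : ∀ F, F ∈ S ↔ (∃ j ∈ box d n, F ∈ facets n c j) ∨
      ∃ j ∈ box d n, key j < key i ∧ F ∈ apexFacets n j) :
    Shelled (2 * d) (S ∪ apexFacets n i) := by
  refine hS.attach_cell apex_notMem_cell (fun x y => x ∈ walls (box d n) i ∧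
    (y = Vertex.apex ∨ ∃ l', 2 ≤ i l' ∧ y = vt i l' true)) ?_ ?_ ?_
  · rintro x y ⟨hx, hy⟩
    have hx₀ := hx
    obtain ⟨l, e, he, rfl⟩ := mem_walls.1 hx₀
    rcases hy with rfl | ⟨l', hl', rfl⟩
    · obtain ⟨F, hF, hsub⟩ := exists_cellFacet_of_subset (H := (cell i).erase (vt i l e))
        (w := Vertex.o (level i)) (y := Vertex.o (level i))
        ((Finset.erase_subset _ _).trans (Finset.subset_insert _ _))
        (vt_mem_walls.2 (wall_slab_of_wall_box he)) (by simp) (Finset.mem_insert_self _ _)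
        (fun h => o_notMem_cell (Finset.mem_of_mem_erase h)) (Flipped n c i)
      refine ⟨hx, Finset.mem_insert_self _ _, F, (hmem F).2 (Or.inl ⟨i, hi, hF⟩), ?_⟩
      rw [Finset.erase_right_comm, Finset.erase_insert apex_notMem_cell]
      exact hsub
    · have hst := (step_true_mem_box hi).2 hl'
      refine ⟨hx, Finset.mem_insert_of_mem (Finset.mem_sdiff.2 ⟨vt_mem_self _ _ _, ?_⟩), ?_⟩
      · rwa [vt_mem_walls, not_not]
      · obtain ⟨j, hj, -, ⟨x', hx', y', hy', hsub⟩, hord⟩ :=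
          exists_neighbor ordConnected_box (fun j hj l => (mem_box.1 hj l).1) hi he hst
        obtain ⟨h1, h2, h3⟩ := erase_erase_subset_of_forall (w := Vertex.apex) rfl
          (walls_subset_cell _ _ hx') (Finset.mem_sdiff.1 hy').1 apex_notMem_cell hsub
        obtain ⟨F, hF, hsub'⟩ :=
          exists_cellFacet_of_subset h1 hx' h2 (Finset.mem_insert_of_mem hy') h3 False
        refine ⟨F, (hmem F).2 (Or.inr ⟨j, hj, hord (Or.inl ⟨rfl, ?_⟩), hF⟩), hsub'⟩
        -- The order condition is vacuous: a step on path `l'` does not affect whether a step on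
        -- path `l` leaves the box.
        rintro hne rfl hss
        have := (step_false_mem_box hst).1 hss
        rw [step_apply, if_neg hne] at this
        exact absurd ((step_false_mem_box hi).2 this) he
  · intro F' hF' z hz
    have hz : z ∈ walls (box d n) i := by simpa using hz
    rcases (hmem F').1 hF' with ⟨j, hj, hF'⟩ | ⟨j, hj, hji, hF'⟩
    · refine ⟨z, _, ⟨hz, Or.inl rfl⟩, Or.inr rfl, Or.inl fun h => ?_⟩
      rcases Finset.mem_insert.1 (subset_of_mem_cellFacets hF' h) with h | h
      · simp at h
      · exact apex_notMem_cell h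
    · obtain ⟨l', hl'⟩ := exists_lt_of_key_lt hji
      have := mem_box.1 hj l'
      refine ⟨z, _, ⟨hz, Or.inr ⟨l', by omega, rfl⟩⟩, Or.inr rfl, Or.inl fun h => ?_⟩
      rcases Finset.mem_insert.1 (subset_of_mem_cellFacets hF' h) with h | h
      · simp [vt] at h
      · have := vt_mem_cell.1 h
        simp at this; omega
  · rintro x x' y y' ⟨h1, h2⟩ ⟨h3, h4⟩
    exact Or.inl ⟨h1, h4⟩

theorem shelled_facets_union_apexFacets (n : ℕ) (c : (Fin d → ℕ) → Bool) :
    Shelled (2 * d) ({F | ∃ i ∈ box d n, F ∈ facets n c i} ∪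
      {F | ∃ i ∈ box d n, F ∈ apexFacets n i}) :=
  (shelled_facets n c).extend key_injective (apexFacets n) (box d n) fun _ hi hS =>
    hS.attach_apex hi fun _ => Iff.rfl

end Slabs


/-! ### Identifying the defined complexes with the generated ones. -/

section Identification

variable {d n : ℕ}

theorem slab_eq_gen (d n k : ℕ) : slab d n k = gen (cell '' (slabIndices d n k : Set _)) := by
  refine SetLike.ext fun H => ?_
  simp only [slab, LowerSet.mem_iSup_iff, mem_gen, Set.exists_mem_image, mem_simplex,
    Finset.mem_coe, exists_prop]

/-- A ridge lies in at most two cells, so it is on the boundary exactly when the step across it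
leaves `Q`. -/
theorem mem_boundary_gen_cell {Q : Finset (Fin d → ℕ)} (hpos : ∀ j ∈ Q, ∀ l, 1 ≤ j l)
    {H : Finset (Vertex d)} :
    H ∈ boundary (gen (cell '' (Q : Set (Fin d → ℕ)))) ↔
      ∃ i ∈ Q, ∃ x ∈ walls Q i, H ⊆ (cell i).erase x := by
  rw [mem_boundary_gen (N := 2 * d) (by rintro _ ⟨i, -, rfl⟩; exact card_cell i)]
  constructor
  · rintro ⟨G, _, ⟨i, hi, rfl⟩, hHG, hGF, hc, hu⟩
    obtain ⟨v, hv, rfl⟩ := exists_erase_of_card_succ hGF hc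
    refine ⟨i, hi, v, ?_, hHG⟩
    obtain ⟨l, e, rfl⟩ := mem_cell.1 hv
    rw [vt_mem_walls]
    intro hst
    have := hu _ ⟨_, hst, rfl⟩
      ((cell_erase_subset_step (hpos i hi l)).trans (Finset.erase_subset _ _))
    exact step_ne (hpos i hi l) (eq_of_cell_subset this.subset)
  · rintro ⟨i, hi, x, hx, hH⟩
    refine ⟨_, _, ⟨i, hi, rfl⟩, hH, Finset.erase_subset _ _,
      Finset.card_erase_add_one (walls_subset_cell _ _ hx), ?_⟩
    rintro _ ⟨j, hj, rfl⟩ hsub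
    obtain ⟨l, e, he, rfl⟩ := mem_walls.1 hx
    rcases eq_or_eq_step hsub with rfl | rfl
    · rfl
    · exact absurd hj he

theorem mem_boundary_slab {k : ℕ} (hk : 1 ≤ k) {H : Finset (Vertex d)} :
    H ∈ boundary (slab d n k) ↔
      ∃ i ∈ slabIndices d n k, ∃ x ∈ walls (slabIndices d n k) i, H ⊆ (cell i).erase x := by
  rw [slab_eq_gen]
  exact mem_boundary_gen_cell fun j hj l => (mem_box.1 ((mem_slabIndices hk).1 hj).1 l).1

/-- A face of a cell on one of the two diagonals of its slab which contains all the walls of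
that cell is interior to the slab. -/
theorem notMem_boundary_slab_of_walls_subset {i : Fin d → ℕ} (hi : i ∈ box d n)
    (hdiag : (∑ l, i l) % (d + 2) = 0 ∨ (∑ l, i l) % (d + 2) = d + 1) {H : Finset (Vertex d)}
    (hH : walls (slabIndices d n (level i)) i ⊆ H) : H ∉ boundary (slab d n (level i)) := by
  rw [mem_boundary_slab (k := level i) (Nat.succ_pos _)]
  rintro ⟨j, hj, x, hx, hsub⟩
  obtain ⟨hjb, hlev⟩ := mem_slab_level.1 hj
  obtain ⟨m, e, he, rfl⟩ := mem_walls.1 hx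
  have hxi : vt j m e ∉ walls (slabIndices d n (level i)) i := fun h =>
    (Finset.mem_erase.1 (hsub (hH h))).1 rfl
  have hcell : ∀ l f, step i l f ∉ slabIndices d n (level i) →
      i l + f.toNat = j l ∨ i l + f.toNat = j l + 1 := fun l f h =>
    vt_mem_cell.1 (Finset.mem_of_mem_erase (hsub (hH (vt_mem_walls.2 h))))
  have hne : ∀ f, step i m f ∉ slabIndices d n (level i) →
      i m + f.toNat ≠ j m + e.toNat := fun f h heq =>
    hxi (by rw [vt_eq_vt.2 ⟨rfl, heq.symm⟩]; exact vt_mem_walls.2 h)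
  have hq : (∑ l, j l) / (d + 2) = (∑ l, i l) / (d + 2) := Nat.succ_injective hlev
  have hdi := Nat.div_add_mod (∑ l, i l) (d + 2)
  have hdj := Nat.div_add_mod (∑ l, j l) (d + 2)
  rw [hq] at hdj
  have hbi := mem_box.1 hi
  have hbj := mem_box.1 hjb
  have hij : i ≠ j := fun h => by
    subst h
    exact hxi hx
  have hbi' := hbi m
  have hbj' := hbj m
  rw [← hlev] at he
  rcases hdiag with h0 | h0
  · have hw : ∀ l, step i l true ∉ slabIndices d n (level i) := fun l h =>
      ((step_true_mem_slab hi).1 h).2 h0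
    have hle : ∀ l, i l ≤ j l ∧ j l ≤ i l + 1 := fun l => by
      have := hcell l true (hw l)
      simp at this
      omega
    -- As `i ≠ j`, the residue of `j` is between 1 and d, so its wall is on the boundary of the box.
    -- That vertex is then also a wall of `i`, although `H` omits it. The upper diagonal is
    -- symmetric.
    have hs1 : ∑ l, j l ≤ ∑ l, i l + d := by
      have : ∑ l, j l ≤ ∑ l, (i l + 1) := Finset.sum_le_sum fun l _ => (hle l).2
      simpa [Finset.sum_add_distrib] using this
    have hs2 : ∑ l, i l ≠ ∑ l, j l := fun h => hij (funext fun l =>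
      (Finset.sum_eq_sum_iff_of_le fun l _ => (hle l).1).1 h l (Finset.mem_univ l))
    have h1 := hne true (hw m)
    have h2 := hle m
    cases e
    · rw [step_false_mem_slab hjb] at he
      by_cases him : i m = n - 1
      · refine hne false ?_ ?_
        · rw [step_false_mem_slab hi]
          omega
        · simp; omega
      · simp at h1; omega
    · rw [step_true_mem_slab hjb] at he
      simp at h1; omega
  · have hw : ∀ l, step i l false ∉ slabIndices d n (level i) := fun l h =>
      ((step_false_mem_slab hi).1 h).2 h0
    have hle : ∀ l, j l ≤ i l ∧ i l ≤ j l + 1 := fun l => by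
      have := hcell l false (hw l)
      simp at this
      omega
    have hs1 : ∑ l, i l ≤ ∑ l, j l + d := by
      have : ∑ l, i l ≤ ∑ l, (j l + 1) := Finset.sum_le_sum fun l _ => (hle l).2
      simpa [Finset.sum_add_distrib] using this
    have hs2 : ∑ l, j l ≠ ∑ l, i l := fun h => hij (funext fun l =>
      ((Finset.sum_eq_sum_iff_of_le fun l _ => (hle l).1).1 h l (Finset.mem_univ l)).symm)
    have h1 := hne false (hw m)
    have h2 := hle m
    cases e
    · rw [step_false_mem_slab hjb] at he
      simp at h1; omega
    · rw [step_true_mem_slab hjb] at he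
      by_cases him : i m = 1
      · refine hne true ?_ ?_
        · rw [step_true_mem_slab hi]
          omega
        · simp; omega
      · simp at h1; omega

theorem mem_cellBoundary {i : Fin d → ℕ} (hi : i ∈ box d n)
    (hdiag : (∑ l, i l) % (d + 2) = 0 ∨ (∑ l, i l) % (d + 2) = d + 1) {H : Finset (Vertex d)} :
    H ∈ cellBoundary n (level i) i ↔
      H ⊆ cell i ∧ ¬ walls (slabIndices d n (level i)) i ⊆ H := by
  constructor
  · rintro ⟨h1, h2⟩
    exact ⟨h1, fun h => notMem_boundary_slab_of_walls_subset hi hdiag h h2⟩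
  · rintro ⟨h1, h2⟩
    refine ⟨h1, (mem_boundary_slab (Nat.succ_pos _)).2 ⟨i, self_mem_slab hi, ?_⟩⟩
    obtain ⟨x, hx, hxH⟩ := Finset.not_subset.1 h2
    exact ⟨x, hx, Finset.subset_erase.2 ⟨h1, hxH⟩⟩

theorem missingFace_eq {V : Type*} {Δ : SComplex V} {F : Finset V} (h : IsMissingFace Δ F)
    (hu : ∀ G, IsMissingFace Δ G → G = F) : missingFace Δ = F := by
  have hex : ∃ F, IsMissingFace Δ F := ⟨F, h⟩
  rw [missingFace, dif_pos hex]
  exact hu _ hex.choose_spec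

/-- The faces of D_σ are the subsets of σ not containing all walls, so the walls are the only
missing face. There is at least one wall per path, and d ≥ 2 ensures that single walls are faces. -/
theorem cellF_eq_walls (hd : 2 ≤ d) {i : Fin d → ℕ} (hi : i ∈ box d n)
    (hdiag : (∑ l, i l) % (d + 2) = 0 ∨ (∑ l, i l) % (d + 2) = d + 1) :
    cellF n (level i) i = walls (slabIndices d n (level i)) i := by
  have hcell := walls_subset_cell (slabIndices d n (level i)) i
  refine missingFace_eq ⟨fun v hv => ?_, fun h => ?_, fun G hG => ?_⟩ ?_
  · rw [mem_cellBoundary hi hdiag]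
    refine ⟨Finset.singleton_subset_iff.2 (hcell hv), fun hsub => ?_⟩
    obtain ⟨e, he⟩ : ∃ e, ∀ l, vt i l e ∈ walls (slabIndices d n (level i)) i := by
      rcases hdiag with h | h
      · exact ⟨true, fun l => vt_mem_walls.2 fun h' => ((step_true_mem_slab hi).1 h').2 h⟩
      · exact ⟨false, fun l => vt_mem_walls.2 fun h' => ((step_false_mem_slab hi).1 h').2 h⟩
    have h0 := Finset.mem_singleton.1 (hsub (he ⟨0, by omega⟩))
    have h1 := Finset.mem_singleton.1 (hsub (he ⟨1, by omega⟩))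
    have := (vt_inj.1 (h0.trans h1.symm)).1
    simp at this
  · exact ((mem_cellBoundary hi hdiag).1 h).2 subset_rfl
  · exact (mem_cellBoundary hi hdiag).2 ⟨hG.1.trans hcell, hG.2⟩
  · rintro G ⟨h1, h2, h3⟩
    have hGc : G ⊆ cell i := fun v hv =>
      ((mem_cellBoundary hi hdiag).1 (h1 v hv)).1 (Finset.mem_singleton_self v)
    have hsub : walls (slabIndices d n (level i)) i ⊆ G := by
      by_contra hcon
      exact h2 ((mem_cellBoundary hi hdiag).2 ⟨hGc, hcon⟩)
    by_contra hne
    have := h3 _ (hsub.ssubset_of_ne (Ne.symm hne))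
    exact ((mem_cellBoundary hi hdiag).1 this).2 subset_rfl

theorem cellTriangulation_eq_gen (hd : 2 ≤ d) {i : Fin d → ℕ} (hi : i ∈ box d n)
    (hdiag : (∑ l, i l) % (d + 2) = 0 ∨ (∑ l, i l) % (d + 2) = d + 1) (b : Bool) :
    cellTriangulation n (level i) b i = gen (cellFacets (slabIndices d n (level i))
      (Vertex.o (level i)) (b = true) i) := by
  have hcell := walls_subset_cell (slabIndices d n (level i)) i
  have hunion : walls (slabIndices d n (level i)) i ∪
      insert (Vertex.o (level i)) (cell i \ walls (slabIndices d n (level i)) i) =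
      insert (Vertex.o (level i)) (cell i) := by
    rw [Finset.union_insert, Finset.union_sdiff_of_subset hcell]
  have hdisj : Disjoint (walls (slabIndices d n (level i)) i)
      (insert (Vertex.o (level i)) (cell i \ walls (slabIndices d n (level i)) i)) := by
    rw [Finset.disjoint_insert_right]
    exact ⟨fun h => o_notMem_cell (hcell h), Finset.disjoint_sdiff⟩
  refine SetLike.ext fun H => ?_
  rw [cellTriangulation, cellG, cellF_eq_walls hd hi hdiag, cone_simplex, mem_gen]
  cases b
  · rw [if_neg (by simp), join_comm, mem_join_boundary hdisj.symm, Finset.union_comm, hunion]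
    constructor
    · rintro ⟨z, hz, h⟩
      exact ⟨_, ⟨z, Or.inr ⟨by simp, hz⟩, rfl⟩, h⟩
    · rintro ⟨_, ⟨z, hz, rfl⟩, h⟩
      exact ⟨z, by simpa using hz, h⟩
  · rw [if_pos rfl, mem_join_boundary hdisj, hunion]
    constructor
    · rintro ⟨z, hz, h⟩
      exact ⟨_, ⟨z, Or.inl ⟨rfl, hz⟩, rfl⟩, h⟩
    · rintro ⟨_, ⟨z, hz, rfl⟩, h⟩
      exact ⟨z, by simpa using hz, h⟩

theorem mem_diagLow {k : ℕ} (hk : 1 ≤ k) {i : Fin d → ℕ} : i ∈ diagLow d n k ↔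
    i ∈ slabIndices d n k ∧ (∑ l, i l) % (d + 2) = 0 := by
  rw [diagLow, Finset.mem_filter]
  refine and_congr_right fun hi => ?_
  obtain ⟨-, rfl⟩ := (mem_slabIndices hk).1 hi
  have := Nat.div_add_mod (∑ l, i l) (d + 2)
  rw [level, Nat.add_sub_cancel, mul_comm]
  omega

theorem mem_diagUp {k : ℕ} (hk : 1 ≤ k) {i : Fin d → ℕ} : i ∈ diagUp d n k ↔
    i ∈ slabIndices d n k ∧ (∑ l, i l) % (d + 2) = d + 1 := by
  rw [diagUp, Finset.mem_filter]
  refine and_congr_right fun hi => ?_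
  obtain ⟨-, rfl⟩ := (mem_slabIndices hk).1 hi
  have := Nat.div_add_mod (∑ l, i l) (d + 2)
  have h : ((∑ l, i l) / (d + 2) + 1) * (d + 2) =
    (d + 2) * ((∑ l, i l) / (d + 2)) + (d + 2) := by ring
  rw [level, h]
  omega

/-- A boundary ridge lies in exactly one cell of the slab, so avoiding all D_σ means that this cell
is off the diagonals. -/
theorem mem_connectingFaces {k : ℕ} (hk : 1 ≤ k) {τ : Finset (Vertex d)} :
    τ ∈ connectingFaces d n k ↔ ∃ i ∈ slabIndices d n k, (∑ l, i l) % (d + 2) ≠ 0 ∧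
      (∑ l, i l) % (d + 2) ≠ d + 1 ∧ ∃ x ∈ walls (slabIndices d n k) i,
        τ = (cell i).erase x := by
  constructor
  · rintro ⟨hτ, hcard, hdiag⟩
    obtain ⟨i, hi, x, hx, hsub⟩ := (mem_boundary_slab hk).1 hτ
    have hxc := walls_subset_cell _ _ hx
    have hτe : τ = (cell i).erase x := by
      refine Finset.eq_of_subset_of_card_le hsub ?_
      rw [Finset.card_erase_of_mem hxc, card_cell]
      omega
    have hmem : τ ∈ cellBoundary n k i := ⟨hsub.trans (Finset.erase_subset _ _), hτ⟩
    refine ⟨i, hi, fun h => ?_, fun h => ?_, x, hx, hτe⟩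
    · exact hdiag i (Finset.mem_union_left _ ((mem_diagLow hk).2 ⟨hi, h⟩)) hmem
    · exact hdiag i (Finset.mem_union_right _ ((mem_diagUp hk).2 ⟨hi, h⟩)) hmem
  · rintro ⟨i, hi, h0, h1, x, hx, rfl⟩
    have hxc := walls_subset_cell _ _ hx
    have hcard := Finset.card_erase_add_one hxc
    rw [card_cell] at hcard
    refine ⟨(mem_boundary_slab hk).2 ⟨i, hi, x, hx, subset_rfl⟩, by omega, ?_⟩
    rintro j hj ⟨hsub, -⟩
    have hj : j ∈ slabIndices d n k ∧
        ((∑ l, j l) % (d + 2) = 0 ∨ (∑ l, j l) % (d + 2) = d + 1) := by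
      rcases Finset.mem_union.1 hj with hj | hj
      · have := (mem_diagLow hk).1 hj
        exact ⟨this.1, Or.inl this.2⟩
      · have := (mem_diagUp hk).1 hj
        exact ⟨this.1, Or.inr this.2⟩
    obtain ⟨l, e, he, rfl⟩ := mem_walls.1 hx
    rcases eq_or_eq_step hsub with rfl | rfl
    · exact hj.2.elim h0 h1
    · exact he hj.1

/-- Every step leaves a one-cell slab, so all vertices are walls and only `o` can be omitted. -/
theorem facets_of_card_eq_one {c : (Fin d → ℕ) → Bool} {i : Fin d → ℕ} (hi : i ∈ box d n)
    (h1 : (slabIndices d n (level i)).card = 1) {F : Finset (Vertex d)} :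
    F ∈ facets n c i ↔ F = cell i := by
  have hempty : cell i \ walls (slabIndices d n (level i)) i = ∅ := by
    rw [Finset.sdiff_eq_empty_iff_subset]
    intro v hv
    obtain ⟨l, e, rfl⟩ := mem_cell.1 hv
    rw [vt_mem_walls]
    intro hst
    obtain ⟨a, ha⟩ := Finset.card_eq_one.1 h1
    have h2 := self_mem_slab hi
    rw [ha, Finset.mem_singleton] at hst h2
    exact step_ne (mem_box.1 hi l).1 (hst.trans h2.symm)
  have hf : Flipped n c i := Or.inl h1
  rw [facets, cellFacets, hempty]
  simp only [hf, true_and, not_true_eq_false, false_and, or_false]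
  have he : (insert (Vertex.o (level i)) (cell i)).erase (Vertex.o (level i)) = cell i :=
    Finset.erase_insert o_notMem_cell
  constructor
  · rintro ⟨z, hz, rfl⟩
    rw [Finset.mem_insert] at hz
    rcases hz with rfl | hz
    · exact he
    · simp at hz
  · rintro rfl
    exact ⟨_, Finset.mem_insert_self _ _, he.symm⟩

theorem newBall_eq_gen (hd : 2 ≤ d) (c : (Fin d → ℕ) → Bool) {k : ℕ} (hk : 1 ≤ k) :
    newBall n k c = gen {F | ∃ i ∈ slabIndices d n k, F ∈ facets n c i} := by
  refine SetLike.ext fun H => ?_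
  rw [newBall]
  split_ifs with h1
  · rw [slab_eq_gen, mem_gen, mem_gen]
    constructor
    · rintro ⟨_, ⟨i, hi, rfl⟩, hH⟩
      obtain ⟨hib, rfl⟩ := (mem_slabIndices hk).1 hi
      exact ⟨_, ⟨i, hi, (facets_of_card_eq_one hib h1).2 rfl⟩, hH⟩
    · rintro ⟨F, ⟨i, hi, hF⟩, hH⟩
      obtain ⟨hib, rfl⟩ := (mem_slabIndices hk).1 hi
      rw [(facets_of_card_eq_one hib h1).1 hF] at hH
      exact ⟨_, ⟨i, hi, rfl⟩, hH⟩
  · have htri : ∀ i ∈ slabIndices d n k,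
        (∑ l, i l) % (d + 2) = 0 ∨ (∑ l, i l) % (d + 2) = d + 1 →
        cellTriangulation n k (c i) i = gen (facets n c i) := by
      intro i hi hdiag
      obtain ⟨hib, rfl⟩ := (mem_slabIndices hk).1 hi
      have : Flipped n c i ↔ c i = true := by simp [Flipped, h1, hdiag]
      rw [cellTriangulation_eq_gen hd hib hdiag, facets, this]
    simp only [LowerSet.mem_sup_iff, LowerSet.mem_iSup_iff, exists_prop, cone_simplex,
      mem_simplex, mem_gen]
    constructor
    · rintro ((⟨i, hi, hH⟩ | ⟨τ, hτ, hH⟩) | ⟨i, hi, hH⟩)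
      · obtain ⟨hi, h0⟩ := (mem_diagLow hk).1 hi
        rw [htri i hi (Or.inl h0)] at hH
        obtain ⟨F, hF, hH⟩ := hH
        exact ⟨F, ⟨i, hi, hF⟩, hH⟩
      · obtain ⟨i, hi, h2, h3, x, hx, rfl⟩ := (mem_connectingFaces hk).1 hτ
        obtain ⟨hib, rfl⟩ := (mem_slabIndices hk).1 hi
        refine ⟨_, ⟨i, hi, x, Or.inr ⟨?_, hx⟩, rfl⟩, ?_⟩
        · simp [Flipped, h1, h2, h3]
        · rw [Finset.erase_insert_of_ne]
          · exact hH
          · rintro rfl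
            exact o_notMem_cell (walls_subset_cell _ _ hx)
      · obtain ⟨hi, h0⟩ := (mem_diagUp hk).1 hi
        rw [htri i hi (Or.inr h0)] at hH
        obtain ⟨F, hF, hH⟩ := hH
        exact ⟨F, ⟨i, hi, hF⟩, hH⟩
    · rintro ⟨F, ⟨i, hi, hF⟩, hH⟩
      by_cases h2 : (∑ l, i l) % (d + 2) = 0
      · refine Or.inl (Or.inl ⟨i, (mem_diagLow hk).2 ⟨hi, h2⟩, ?_⟩)
        rw [htri i hi (Or.inl h2)]
        exact ⟨F, hF, hH⟩
      by_cases h3 : (∑ l, i l) % (d + 2) = d + 1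
      · refine Or.inr ⟨i, (mem_diagUp hk).2 ⟨hi, h3⟩, ?_⟩
        rw [htri i hi (Or.inr h3)]
        exact ⟨F, hF, hH⟩
      obtain ⟨hib, rfl⟩ := (mem_slabIndices hk).1 hi
      have hf : ¬ Flipped n c i := by simp [Flipped, h1, h2, h3]
      obtain ⟨x, hx, rfl⟩ := hF
      have hx : x ∈ walls (slabIndices d n (level i)) i := by simpa [hf] using hx
      refine Or.inl (Or.inr ⟨_, (mem_connectingFaces hk).2 ⟨i, hi, h2, h3, x, hx, rfl⟩, ?_⟩)
      rw [Finset.erase_insert_of_ne] at hH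
      · exact hH
      · rintro rfl
        exact o_notMem_cell (walls_subset_cell _ _ hx)

theorem fullBall_eq_gen (hd : 2 ≤ d) (c : (Fin d → ℕ) → Bool) :
    fullBall n c = gen {F | ∃ i ∈ box d n, F ∈ facets n c i} := by
  refine SetLike.ext fun H => ?_
  simp only [fullBall, LowerSet.mem_iSup_iff, exists_prop]
  constructor
  · rintro ⟨k, hk, hH⟩
    have hk := (Finset.mem_Icc.1 hk).1
    rw [newBall_eq_gen hd c hk] at hH
    obtain ⟨F, ⟨i, hi, hF⟩, hH⟩ := hH
    exact ⟨F, ⟨i, ((mem_slabIndices hk).1 hi).1, hF⟩, hH⟩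
  · rintro ⟨F, ⟨i, hi, hF⟩, hH⟩
    refine ⟨level i, Finset.mem_Icc.2 ⟨Nat.succ_pos _, ?_⟩, ?_⟩
    · refine Nat.succ_le_succ (Nat.div_le_div_right ?_)
      have : ∑ l, i l ≤ ∑ _l : Fin d, (n - 1) :=
        Finset.sum_le_sum fun l _ => (mem_box.1 hi l).2
      simpa using this
    · rw [newBall_eq_gen hd c (k := level i) (Nat.succ_pos _)]
      exact ⟨F, ⟨i, self_mem_slab hi, hF⟩, hH⟩

/-- A common facet contains a ridge of the cell `i` that `j` shares, so `j` is a step of `i`; it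
also contains `o`, so the levels agree. The omitted vertex is therefore not a wall. -/
theorem flipped_of_mem_facets {c : (Fin d → ℕ) → Bool} {i j : Fin d → ℕ} (hj : j ∈ box d n)
    {F : Finset (Vertex d)} (hFi : F ∈ facets n c i) (hFj : F ∈ facets n c j) (hij : j ≠ i) :
    level j = level i ∧ Flipped n c i ∧ ∃ l e, j = step i l e := by
  have hsub := subset_of_mem_cellFacets hFj
  obtain ⟨z, hz, rfl⟩ := hFi
  have hcell : (cell i).erase z ⊆ cell j := by
    intro v hv
    obtain ⟨h1, h2⟩ := Finset.mem_erase.1 hv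
    refine (Finset.mem_insert.1
      (hsub (Finset.mem_erase.2 ⟨h1, Finset.mem_insert_of_mem h2⟩))).resolve_left ?_
    rintro rfl
    exact o_notMem_cell h2
  have hzc : z ∈ cell i := by
    by_contra hzc
    rw [Finset.erase_eq_of_notMem hzc] at hcell
    exact hij (eq_of_cell_subset hcell).symm
  obtain ⟨l, e, rfl⟩ := mem_cell.1 hzc
  have hst : j = step i l e := (eq_or_eq_step hcell).resolve_left hij
  have hlev : level j = level i := by
    have : Vertex.o (level i) ∈ insert (Vertex.o (level j)) (cell j) :=
      hsub (Finset.mem_erase.2 ⟨by simp [vt], Finset.mem_insert_self _ _⟩)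
    rcases Finset.mem_insert.1 this with h | h
    · simpa using h.symm
    · exact absurd h o_notMem_cell
  refine ⟨hlev, ?_, l, e, hst⟩
  by_contra hf
  have hz : step i l e ∉ slabIndices d n (level i) := by
    simpa [hf, vt_mem_walls] using hz
  exact hz (mem_slab_level.2 ⟨hst ▸ hj, hst ▸ hlev⟩)

/-- A facet comes from only one cell. -/
theorem eq_of_mem_facets (hd : 2 ≤ d) {c : (Fin d → ℕ) → Bool} {i j : Fin d → ℕ}
    (hi : i ∈ box d n) (hj : j ∈ box d n) {F : Finset (Vertex d)} (hFi : F ∈ facets n c i)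
    (hFj : F ∈ facets n c j) : j = i := by
  by_contra hij
  obtain ⟨hlev, hfi, l, e, hst⟩ := flipped_of_mem_facets hj hFi hFj hij
  obtain ⟨-, hfj, -⟩ := flipped_of_mem_facets hi hFj hFi (Ne.symm hij)
  have hcard : (slabIndices d n (level i)).card ≠ 1 := by
    intro h
    obtain ⟨a, ha⟩ := Finset.card_eq_one.1 h
    have h1 := self_mem_slab hi
    have h2 : j ∈ slabIndices d n (level i) := mem_slab_level.2 ⟨hj, hlev⟩
    rw [ha, Finset.mem_singleton] at h1 h2
    exact hij (h2.trans h1.symm)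
  have hq : (∑ l, j l) / (d + 2) = (∑ l, i l) / (d + 2) := Nat.succ_injective hlev
  have hdi := Nat.div_add_mod (∑ l, i l) (d + 2)
  have hdj := Nat.div_add_mod (∑ l, j l) (d + 2)
  rw [hq] at hdj
  have h1 := (hfi.resolve_left hcard).1
  have h2 := (hfj.resolve_left (hlev ▸ hcard)).1
  -- Both cells are on diagonals of one slab, so their sums are equal or differ by d + 1, whereas
  -- adjacent sums differ by 1.
  have hs : ∑ m, j m + 1 = ∑ m, i m ∨ ∑ m, j m = ∑ m, i m + 1 := by
    rw [hst]
    cases e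
    · exact Or.inr (sum_step_false i l)
    · exact Or.inl (sum_step_true (mem_box.1 hi l).1)
  omega

theorem card_of_mem_facets {c : (Fin d → ℕ) → Bool} {i : Fin d → ℕ} {F : Finset (Vertex d)}
    (hF : F ∈ facets n c i) : F.card = 2 * d :=
  card_of_mem_cellFacets o_notMem_cell hF

/-- Ridges inside the ball of a cell lie in two of its facets, and ridges W \ {x, y} with `y` a
non-wall of the cell continue into another cell. Those with `y = o` continue into the neighbouring
slab unless `x` is a wall of the whole box. -/
theorem boundary_fullBall (hd : 2 ≤ d) (c : (Fin d → ℕ) → Bool) :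
    boundary (fullBall n c) =
      gen {F | ∃ i ∈ box d n, ∃ x ∈ walls (box d n) i, F = (cell i).erase x} := by
  refine SetLike.ext fun H => ?_
  rw [fullBall_eq_gen hd c, mem_boundary_gen (N := 2 * d)
    (by rintro F ⟨i, -, hF⟩; exact card_of_mem_facets hF)]
  constructor
  · rintro ⟨G, F, ⟨i, hi, hF⟩, hHG, hGF, hcard, hu⟩
    obtain ⟨u, hu', rfl⟩ := exists_erase_of_card_succ hGF hcard
    have hu : ∀ j ∈ box d n, ∀ F' ∈ facets n c j, F.erase u ⊆ F' → F' = F :=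
      fun j hj F' hF' => hu F' ⟨j, hj, hF'⟩
    have hF₀ := hF
    obtain ⟨z, hz, rfl⟩ := hF
    obtain ⟨huz, huW⟩ := Finset.mem_erase.1 hu'
    -- Otherwise W \ `u` would be a second facet containing the ridge. Hence one of `z`, `u` is a
    -- wall and the other is not.
    have hswap : ¬((Flipped n c i ∧
        u ∈ insert (Vertex.o (level i)) (cell i \ walls (slabIndices d n (level i)) i)) ∨
        (¬Flipped n c i ∧ u ∈ walls (slabIndices d n (level i)) i)) := by
      intro h
      have := hu i hi _ ⟨u, h, rfl⟩ (Finset.erase_subset_erase _ (Finset.erase_subset _ _))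
      rw [← this] at hu'
      simp at hu'
    obtain ⟨x, y, hx, hy, hG⟩ : ∃ x y, x ∈ walls (slabIndices d n (level i)) i ∧
        y ∈ insert (Vertex.o (level i)) (cell i \ walls (slabIndices d n (level i)) i) ∧
        ((insert (Vertex.o (level i)) (cell i)).erase z).erase u =
          ((insert (Vertex.o (level i)) (cell i)).erase x).erase y := by
      rcases hz with ⟨hf, hz⟩ | ⟨hf, hz⟩
      · refine ⟨u, z, ?_, hz, Finset.erase_right_comm⟩
        by_contra hcon
        refine hswap (Or.inl ⟨hf, ?_⟩)
        rw [Finset.mem_insert, Finset.mem_sdiff]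
        exact (Finset.mem_insert.1 huW).imp_right fun h => ⟨h, hcon⟩
      · refine ⟨z, u, hz, ?_, rfl⟩
        rw [Finset.mem_insert, Finset.mem_sdiff]
        exact (Finset.mem_insert.1 huW).imp_right fun h =>
          ⟨h, fun h' => hswap (Or.inr ⟨hf, h'⟩)⟩
    rw [hG] at hHG hu
    obtain ⟨l, e, he, rfl⟩ := mem_walls.1 hx
    have hother : ∀ j ∈ box d n, j ≠ i → ∀ F' ∈ facets n c j,
        ¬((insert (Vertex.o (level i)) (cell i)).erase (vt i l e)).erase y ⊆ F' := by
      intro j hj hji F' hF' hsub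
      have := hu j hj F' hF' hsub
      exact hji (eq_of_mem_facets hd hi hj hF₀ (this ▸ hF'))
    rcases Finset.mem_insert.1 hy with rfl | hy
    · rw [Finset.erase_right_comm, Finset.erase_insert o_notMem_cell] at hHG hother
      refine ⟨_, ⟨i, hi, _, vt_mem_walls.2 fun hb => ?_, rfl⟩, hHG⟩
      obtain ⟨F', hF', hsub⟩ := exists_facet_of_wall c hi he hb
      exact hother _ hb (step_ne (mem_box.1 hi l).1) F' hF' hsub
    · obtain ⟨hyc, hyw⟩ := Finset.mem_sdiff.1 hy
      obtain ⟨l', e', rfl⟩ := mem_cell.1 hyc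
      rw [vt_mem_walls, not_not] at hyw
      obtain ⟨j, hj, hji, ⟨F', hF', hsub⟩, -⟩ := exists_facet_of_neighbor c hi he hyw
      exact absurd hsub (hother j hj hji F' hF')
  · rintro ⟨_, ⟨i, hi, x, hx, rfl⟩, hH⟩
    obtain ⟨l, e, he, rfl⟩ := mem_walls.1 hx
    have hxw := vt_mem_walls.2 (wall_slab_of_wall_box he)
    have hxc := vt_mem_self i l e
    obtain ⟨F, hF, hsub⟩ := exists_cellFacet_of_subset (H := (cell i).erase (vt i l e))
        (w := Vertex.o (level i)) (y := Vertex.o (level i))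
        ((Finset.erase_subset _ _).trans (Finset.subset_insert _ _))
        hxw (by simp) (Finset.mem_insert_self _ _)
        (fun h => o_notMem_cell (Finset.mem_of_mem_erase h)) (Flipped n c i)
    refine ⟨_, F, ⟨i, hi, hF⟩, hH, hsub, ?_, ?_⟩
    · rw [Finset.card_erase_add_one hxc, card_cell, card_of_mem_facets hF]
    -- Within the ball of `i` the triangulation type determines the one facet over the ridge: it
    -- omits `o` if flipped and the wall itself otherwise.
    · have hcase : ∀ F' ∈ facets n c i, (cell i).erase (vt i l e) ⊆ F' →
          F' = (insert (Vertex.o (level i)) (cell i)).erase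
            (open Classical in if Flipped n c i then Vertex.o (level i) else vt i l e) := by
        rintro _ ⟨z, hz, rfl⟩ hsub'
        have hz' : z ∉ walls (slabIndices d n (level i)) i ∨ z = vt i l e := by
          by_contra! hcon
          have := hsub' (Finset.mem_erase.2 ⟨hcon.2, walls_subset_cell _ _ hcon.1⟩)
          simp at this
        have hz'' : z ∈ cell i → z = vt i l e := by
          intro hzc
          by_contra hcon
          have := hsub' (Finset.mem_erase.2 ⟨hcon, hzc⟩)
          simp at this
        congr 1
        rcases hz with ⟨hf, hz⟩ | ⟨hf, hz⟩
        · rw [if_pos hf]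
          refine (Finset.mem_insert.1 hz).resolve_right fun h => ?_
          obtain ⟨h1, h2⟩ := Finset.mem_sdiff.1 h
          exact h2 (hz'' h1 ▸ hxw)
        · rw [if_neg hf]
          exact hz'' (walls_subset_cell _ _ hz)
      rintro F' ⟨j, hj, hF'⟩ hsub'
      have hij : j = i := by
        have hcj : (cell i).erase (vt i l e) ⊆ cell j := by
          intro v hv
          refine (Finset.mem_insert.1
            (subset_of_mem_cellFacets hF' (hsub' hv))).resolve_left ?_
          rintro rfl
          exact o_notMem_cell (Finset.mem_of_mem_erase hv)
        rcases eq_or_eq_step hcj with h | h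
        · exact h
        · exact absurd (h ▸ hj) he
      subst hij
      rw [hcase F' hF' hsub', hcase F hF hsub]

theorem sphere_eq_gen (hd : 2 ≤ d) (c : (Fin d → ℕ) → Bool) :
    sphere n c = gen ({F | ∃ i ∈ box d n, F ∈ facets n c i} ∪
      {F | ∃ i ∈ box d n, F ∈ apexFacets n i}) := by
  rw [sphere, boundary_fullBall hd, fullBall_eq_gen hd, cone_gen, gen_union]
  congr 2
  ext F
  have herase : ∀ (i : Fin d → ℕ) x, x ∈ walls (box d n) i →
      insert Vertex.apex ((cell i).erase x) = (insert Vertex.apex (cell i)).erase x := by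
    intro i x hx
    rw [Finset.erase_insert_of_ne]
    rintro rfl
    exact apex_notMem_cell (walls_subset_cell _ _ hx)
  constructor
  · rintro ⟨_, ⟨i, hi, x, hx, rfl⟩, rfl⟩
    exact ⟨i, hi, x, Or.inr ⟨not_false, hx⟩, herase i x hx⟩
  · rintro ⟨i, hi, x, hx, rfl⟩
    have hx : x ∈ walls (box d n) i := by simpa using hx
    exact ⟨_, ⟨i, hi, x, hx, rfl⟩, herase i x hx⟩

theorem sphere_facets_nonempty (hd : 2 ≤ d) (hn : 2 ≤ n) (c : (Fin d → ℕ) → Bool) :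
    ({F | ∃ i ∈ box d n, F ∈ facets n c i} ∪
      {F | ∃ i ∈ box d n, F ∈ apexFacets n i}).Nonempty := by
  have hi : (fun _ => 1 : Fin d → ℕ) ∈ box d n := mem_box.2 fun _ => ⟨le_rfl, by omega⟩
  refine ⟨_, Or.inr ⟨_, hi, vt (fun _ => 1) ⟨0, by omega⟩ true, Or.inr ⟨not_false, ?_⟩, rfl⟩⟩
  rw [vt_mem_walls, step_true_mem_box hi]
  simp

end Identification

end NSW

theorem theorem1p1 :
    (∀ (d n : ℕ), 2 ≤ d → 2 ≤ n → ∀ c : (Fin d → ℕ) → Bool,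
      NSW.IsConstructible (2 * (d : ℤ) - 1) (NSW.sphere n c)) ∧
    (∀ (n : ℕ), 2 ≤ n → ∀ c : (Fin 2 → ℕ) → Bool,
      NSW.IsShellable 3 (NSW.sphere n c)) := by
  constructor
  · intro d n hd hn c
    rw [NSW.sphere_eq_gen hd]
    have := (NSW.shelled_facets_union_apexFacets n c).isConstructible
      (NSW.sphere_facets_nonempty hd hn c)
    exact_mod_cast this
  · intro n hn c
    rw [NSW.sphere_eq_gen le_rfl]
    exact (NSW.shelled_facets_union_apexFacets n c).isShellable
      (NSW.sphere_facets_nonempty le_rfl hn c)
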